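/- Let $\omega$ be a finite signed Radon measure on $\mathbb{R}^2$ with variation $|\omega|$, and write $\|\omega\|_{\mathcal M}=|\omega|(\mathbb{R}^2)$ and $M_s(\omega)=\sup_{x\in\mathbb{R}^2}|\omega|(\overline{B}_s(x))$, where $\overline B_s(x)$ is the closed ball of radius $s$ about $x$ (the vorticity maximal function). Assume that $\int_0^1 s^{-1}M_s(\omega)\,ds<\infty$. Let $u=K*\omega$, i.e. $u(x)=\int_{\mathbb{R}^2}K(x-y)\,d\omega(y)$, with the Biot–Savart kernel $K(x)=\frac{1}{2\pi}\frac{x^\perp}{|x|^2}$, $x^\perp=(-x_2,x_1)$. Then this integral converges absolutely for almost every $x$, $u$ is locally integrable with $\operatorname{div}u=0$ and $\operatorname{curl}u=\partial_1u_2-\partial_2u_1=\omega$ in the sense of distributions, and $$\frac{1}{|B_r(0)|}\int_{B_r(0)}\int_{\mathbb{R}^2}|u(x+h)-u(x)|^2\,dx\,dh\;\le\;\|\omega\|_{\mathcal M}\int_0^r\frac{M_s(\omega)}{s}\,ds\;<\;\infty\qquad\text{for all } r\ge 0,$$ where for $r=0$ the left-hand side is understood as $0$. -/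

import Mathlib

open MeasureTheory Set
open scoped ENNReal

noncomputable section

/-- The Euclidean plane. -/
abbrev Plane : Type := EuclideanSpace ℝ (Fin 2)

/-- The integral of `f` against a finite signed measure `ω = ω⁺ - ω⁻` (Jordan decomposition). -/
def signedIntegral {F : Type*} [NormedAddCommGroup F] [NormedSpace ℝ F]
    (ω : SignedMeasure Plane) (f : Plane → F) : F :=
  (∫ y, f y ∂ω.toJordanDecomposition.posPart) - ∫ y, f y ∂ω.toJordanDecomposition.negPart

/-- The Biot-Savart kernel `K(x) = (2π)⁻¹ x^⊥ / |x|²`, where `x^⊥ = (-x₂, x₁)`.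
(At the origin Lean's conventions give the value `0`.) -/
def biotSavartKernel (x : Plane) : Plane :=
  (1 / (2 * Real.pi * ‖x‖ ^ 2)) • !₂[-(x 1), x 0]

/-- The velocity `u = K ∗ ω`, i.e. `u(x) = ∫ K(x - y) dω(y)`. -/
def biotSavartVelocity (ω : SignedMeasure Plane) (x : Plane) : Plane :=
  signedIntegral ω fun y => biotSavartKernel (x - y)

/-- The vorticity maximal function `M_s(ω) = sup_x |ω|(closed ball of radius s around x)`. -/
def vorticityMaximal (ω : SignedMeasure Plane) (s : ℝ) : ℝ≥0∞ :=
  ⨆ x : Plane, ω.totalVariation (Metric.closedBall x s)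

/-- The integral `∫_0^r M_s(ω) / s ds`. -/
def vorticityMaximalIntegral (ω : SignedMeasure Plane) (r : ℝ) : ℝ≥0∞ :=
  ∫⁻ s in Ioc 0 r, vorticityMaximal ω s / ENNReal.ofReal s

/-- The norm `‖ω‖_M = |ω|(ℝ²)`. -/
def measureNorm (ω : SignedMeasure Plane) : ℝ≥0∞ :=
  ω.totalVariation univ

/-- The average over `h ∈ B_r(0)` of `∫ |u(x + h) - u(x)|² dx`. -/
def structureAverage (u : Plane → Plane) (r : ℝ) : ℝ≥0∞ :=
  ⨍⁻ h in Metric.ball (0 : Plane) r, (∫⁻ x : Plane, ‖u (x + h) - u x‖ₑ ^ 2 ∂volume) ∂volume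

/-- The partial derivative `∂φ/∂x_i`. -/
def planePartial (i : Fin 2) (φ : Plane → ℝ) (x : Plane) : ℝ :=
  fderiv ℝ φ x (EuclideanSpace.single i 1)

/-- `div u = 0` in the sense of distributions. -/
def WeakDivFree (u : Plane → Plane) : Prop :=
  ∀ φ : Plane → ℝ, ContDiff ℝ ((⊤ : ℕ∞) : WithTop ℕ∞) φ → HasCompactSupport φ →
    ∫ x, (u x 0 * planePartial 0 φ x + u x 1 * planePartial 1 φ x) = 0

/-- `curl u = ∂₁u₂ - ∂₂u₁ = ω` in the sense of distributions. -/
def WeakCurlEq (u : Plane → Plane) (ω : SignedMeasure Plane) : Prop :=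
  ∀ φ : Plane → ℝ, ContDiff ℝ ((⊤ : ℕ∞) : WithTop ℕ∞) φ → HasCompactSupport φ →
    ∫ x, (u x 0 * planePartial 1 φ x - u x 1 * planePartial 0 φ x) = signedIntegral ω φ

end

/-! Write ω = σμ with μ = |ω| and |σ| ≤ 1. With D_hK(x) = K(x+h) - K(x), expanding the square gives
∫|u(x+h) - u(x)|² dx as the double integral of σ(y)σ(z) G_h(y - z) against μ × μ, where G_h(w) = ∫
D_hK(x)·D_hK(x+w) dx.

G_h is a second difference of the logarithm: G_h(w) = (2π)⁻¹(log|w+h| + log|w-h| - 2 log|w|)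
(`integral_inner_increment_increment`). On circles |x| = ρ the dot product of two kernels is the
real part of z/(z-a) up to a factor, and Cauchy's formula evaluates its average.

Averaging in h, the circle average of log|w+h| over |h| = ρ is log max(ρ, |w|), so the integral of
G_h(w) over B_r lies between 0 and r² log⁺(r/|w|) (`setIntegral_ball_integral_increment`). Finally
log⁺(r/|y-z|) is the integral of 1_{|y-z| ≤ s}/s over (0, r], and integrating in z produces
μ(B̄_s(y))/s ≤ M_s/s (`lintegral_truncatedLog_le`).

Fubini is justified by cruder absolute bounds (`integrable_incrementForm`): D_hK has two
singularities of order one and decays like |x|⁻², and the hypothesis makes the logarithmic energy of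
μ finite. The equations for u reduce to those for K, read off in polar coordinates: K is tangential
to circles and has flux-normalised size 1/(2π|x|). -/

noncomputable section

/-! ### Sign density of ω and algebra of the kernel. -/

/-- The sign of a signed measure with respect to its total variation. -/
lemma exists_sign_density (ω : SignedMeasure Plane) :
    ∃ σ : Plane → ℝ, Measurable σ ∧ (∀ x, |σ x| ≤ 1) ∧
      ∀ {F : Type} [NormedAddCommGroup F] [NormedSpace ℝ F] (f : Plane → F),
        Integrable f ω.totalVariation →
          signedIntegral ω f = ∫ y, σ y • f y ∂ω.totalVariation := by
  obtain ⟨S, hS, hp, hn⟩ := ω.toJordanDecomposition.mutuallySingular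
  have hpos : ω.toJordanDecomposition.posPart = ω.totalVariation.restrict Sᶜ := by
    rw [SignedMeasure.totalVariation, Measure.restrict_add, Measure.restrict_eq_zero.2 hn, add_zero,
      Measure.restrict_eq_self_of_ae_mem]
    rw [ae_iff]; simpa using hp
  have hneg : ω.toJordanDecomposition.negPart = ω.totalVariation.restrict S := by
    rw [SignedMeasure.totalVariation, Measure.restrict_add, Measure.restrict_eq_zero.2 hp, zero_add,
      Measure.restrict_eq_self_of_ae_mem]
    rw [ae_iff]; exact hn
  -- S is null for the positive part and its complement for the negative part, so the density is +1
  -- off S and -1 on S.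
  refine ⟨fun x => Sᶜ.indicator 1 x - S.indicator 1 x,
    (measurable_one.indicator hS.compl).sub (measurable_one.indicator hS), fun x => ?_, ?_⟩
  · by_cases hx : x ∈ S <;> simp [hx]
  · intro F _ _ f hf
    have h1 := hf.indicator hS.compl
    have h2 := hf.indicator hS
    rw [signedIntegral, hpos, hneg, ← integral_indicator hS.compl, ← integral_indicator hS,
      ← integral_sub h1 h2]
    refine integral_congr_ae (.of_forall fun x => ?_)
    by_cases hx : x ∈ S <;> simp [hx]

lemma norm_biotSavartKernel (x : Plane) : ‖biotSavartKernel x‖ = (2 * Real.pi * ‖x‖)⁻¹ := by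
  have : ‖(!₂[-(x 1), x 0] : Plane)‖ = ‖x‖ := by
    simp [EuclideanSpace.norm_eq, Fin.sum_univ_two, add_comm]
  rw [biotSavartKernel, norm_smul, this, Real.norm_eq_abs, abs_of_nonneg (by positivity)]
  by_cases hx : ‖x‖ = 0
  · simp [hx]
  · field_simp

@[fun_prop]
lemma measurable_biotSavartKernel : Measurable biotSavartKernel := by
  unfold biotSavartKernel
  have h1 : Measurable fun x : Plane => 1 / (2 * Real.pi * ‖x‖ ^ 2) := by fun_prop
  have h2 : Continuous fun x : Plane => (!₂[-(x 1), x 0] : Plane) := by fun_prop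
  exact h1.smul h2.measurable

lemma inner_plane (x y : Plane) : inner ℝ x y = x 0 * y 0 + x 1 * y 1 := by
  simp [PiLp.inner_apply, Fin.sum_univ_two, mul_comm]

lemma inner_biotSavartKernel (x y : Plane) : inner ℝ (biotSavartKernel x) (biotSavartKernel y) =
    inner ℝ x y / (4 * Real.pi ^ 2 * ‖x‖ ^ 2 * ‖y‖ ^ 2) := by
  simp only [biotSavartKernel, inner_smul_left, inner_smul_right, inner_plane]
  simp
  ring

/-- Up to a rotation and the factor 1/(2π), K is the inversion x/|x|²; this is the distance formula
for inversions. It makes increments of K decay like |x|⁻², hence square integrable at infinity, as K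
itself is not. -/
lemma norm_biotSavartKernel_sub {x y : Plane} (hx : x ≠ 0) (hy : y ≠ 0) :
    ‖biotSavartKernel x - biotSavartKernel y‖ = ‖x - y‖ / (2 * Real.pi * ‖x‖ * ‖y‖) := by
  have hx' := norm_ne_zero_iff.2 hx
  have hy' := norm_ne_zero_iff.2 hy
  have hpi := Real.pi_ne_zero
  rw [← sq_eq_sq₀ (by positivity) (by positivity), norm_sub_sq_real, inner_biotSavartKernel,
    norm_biotSavartKernel, norm_biotSavartKernel, div_pow, norm_sub_sq_real]
  field_simp
  ring

/-! ### Polar coordinates and circle averages. -/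

/-- The standard isometry between the complex numbers and the plane. -/
def complexPlane : ℂ ≃ₗᵢ[ℝ] Plane := Complex.orthonormalBasisOneI.repr

lemma complexPlane_zero_apply (z : ℂ) : complexPlane z 0 = z.re := by simp [complexPlane]
lemma complexPlane_one_apply (z : ℂ) : complexPlane z 1 = z.im := by simp [complexPlane]

lemma measurePreserving_complexPlane : MeasurePreserving complexPlane :=
  complexPlane.measurePreserving

lemma integral_polar {E : Type*} [NormedAddCommGroup E] [NormedSpace ℝ E] (f : Plane → E) :
    ∫ x, f x = ∫ p in Ioi (0 : ℝ) ×ˢ Ioo (-Real.pi) Real.pi,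
      p.1 • f (complexPlane (circleMap 0 p.1 p.2)) := by
  rw [← measurePreserving_complexPlane.integral_comp
    complexPlane.toHomeomorph.measurableEmbedding, ← Complex.integral_comp_polarCoord_symm]
  simp [circleMap, Complex.exp_mul_I, polarCoord_target]

lemma lintegral_polar (f : Plane → ℝ≥0∞) :
    ∫⁻ x, f x = ∫⁻ p in Ioi (0 : ℝ) ×ˢ Ioo (-Real.pi) Real.pi,
      ENNReal.ofReal p.1 * f (complexPlane (circleMap 0 p.1 p.2)) := by
  rw [← measurePreserving_complexPlane.lintegral_comp_emb
    complexPlane.toHomeomorph.measurableEmbedding, ← Complex.lintegral_comp_polarCoord_symm]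
  simp [circleMap, Complex.exp_mul_I, polarCoord_target]

lemma measurable_circleMap_uncurry : Measurable fun p : ℝ × ℝ => complexPlane (circleMap 0 p.1 p.2) := by
  refine complexPlane.continuous.measurable.comp (Continuous.measurable ?_)
  unfold circleMap
  fun_prop

lemma lintegral_radial {g : ℝ → ℝ≥0∞} (hg : Measurable g) :
    ∫⁻ x : Plane, g ‖x‖ = ENNReal.ofReal (2 * Real.pi) * ∫⁻ ρ in Ioi 0, ENNReal.ofReal ρ * g ρ := by
  rw [lintegral_polar, Measure.volume_eq_prod, ← Measure.prod_restrict, lintegral_prod]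
  · rw [← lintegral_const_mul _ (by fun_prop)]
    refine setLIntegral_congr_fun measurableSet_Ioi fun ρ hρ => ?_
    have : |ρ| = ρ := abs_of_pos hρ
    simp only [LinearIsometryEquiv.norm_map, norm_circleMap_zero, this, lintegral_const]
    simp [Real.volume_Ioo, ← two_mul, mul_comm, mul_assoc]
  · refine (Measurable.mul (by fun_prop) (hg.comp ?_)).aemeasurable
    exact measurable_circleMap_uncurry.norm

lemma integrableOn_polar {E : Type*} [NormedAddCommGroup E] [NormedSpace ℝ E] {f : Plane → E}
    (hf : Integrable f) (hm : StronglyMeasurable f) :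
    IntegrableOn (fun p : ℝ × ℝ => p.1 • f (complexPlane (circleMap 0 p.1 p.2)))
      (Ioi (0 : ℝ) ×ˢ Ioo (-Real.pi) Real.pi) := by
  refine ⟨(StronglyMeasurable.smul measurable_fst.stronglyMeasurable
    (hm.comp_measurable measurable_circleMap_uncurry)).aestronglyMeasurable, ?_⟩
  have := hf.2
  rw [HasFiniteIntegral, lintegral_polar] at this
  refine lt_of_le_of_lt (le_of_eq ?_) this
  refine setLIntegral_congr_fun (measurableSet_Ioi.prod measurableSet_Ioo) fun p hp => ?_
  have : (0 : ℝ) < p.1 := hp.1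
  simp [enorm_smul, Real.enorm_eq_ofReal this.le]

lemma integral_eq_circleAverage {E : Type*} [NormedAddCommGroup E] [NormedSpace ℝ E]
    {f : Plane → E} (hf : Integrable f) (hm : StronglyMeasurable f) :
    ∫ x, f x = ∫ ρ in Ioi (0 : ℝ),
      (2 * Real.pi * ρ) • Real.circleAverage (fun z => f (complexPlane z)) 0 ρ := by
  have h := integrableOn_polar hf hm
  rw [IntegrableOn, Measure.volume_eq_prod, ← Measure.prod_restrict] at h
  rw [integral_polar, Measure.volume_eq_prod, ← Measure.prod_restrict, integral_prod _ h]
  refine setIntegral_congr_fun measurableSet_Ioi fun ρ hρ => ?_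
  have h2 : (2 * Real.pi) ≠ 0 := by positivity
  simp only [integral_smul]
  -- Circle averages run over (0, 2π), polar coordinates over (-π, π); the angle is shifted by -π.
  rw [Real.circleAverage_eq_integral_add (-Real.pi),
    intervalIntegral.integral_comp_add_right (fun θ => f (complexPlane (circleMap 0 ρ θ))),
    intervalIntegral.integral_of_le (by linarith [Real.pi_pos]), integral_Ioc_eq_integral_Ioo,
    smul_smul]
  congr 1
  · field_simp
  · congr 2; ring_nf

/-! ### Correlations of the kernel as differences of logarithms. -/

lemma circleIntegrable_div_sub {a : ℂ} {ρ : ℝ} (hρ : 0 < ρ) (h : ρ ≠ ‖a‖) :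
    CircleIntegrable (fun z : ℂ => z / (z - a)) 0 ρ := by
  refine ContinuousOn.circleIntegrable hρ.le fun z hz => ContinuousAt.continuousWithinAt ?_
  have : z - a ≠ 0 := by
    intro h0
    rw [sub_eq_zero.1 h0] at hz
    simp at hz
    exact h hz.symm
  fun_prop (disch := assumption)

lemma circleIntegrable_re_div_sub {a : ℂ} {ρ : ℝ} (hρ : 0 < ρ) (h : ρ ≠ ‖a‖) :
    CircleIntegrable (fun z : ℂ => (z / (z - a)).re) 0 ρ :=
  ⟨Complex.reCLM.integrable_comp (circleIntegrable_div_sub hρ h).1,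
    Complex.reCLM.integrable_comp (circleIntegrable_div_sub hρ h).2⟩

/-- Against dz/z the integrand becomes the Cauchy kernel 1/(z-a), which gives 1 when a is inside.
When a is outside, z/(z-a) is holomorphic on the disc and its average is its value 0 at the centre.
-/
lemma circleAverage_div_sub {a : ℂ} {ρ : ℝ} (hρ : 0 < ρ) (h : ρ ≠ ‖a‖) :
    Real.circleAverage (fun z : ℂ => z / (z - a)) 0 ρ = if ‖a‖ < ρ then 1 else 0 := by
  split_ifs with hlt
  · rw [Real.circleAverage_eq_circleIntegral hρ.ne']
    have : (∮ z in C(0, ρ), (z - 0)⁻¹ • (z / (z - a))) = ∮ z in C(0, ρ), (z - a)⁻¹ := by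
      refine circleIntegral.integral_congr hρ.le fun z hz => ?_
      have hz0 : z ≠ 0 := by
        rintro rfl
        simp at hz
        exact hρ.ne hz
      simp [div_eq_mul_inv, ← mul_assoc, inv_mul_cancel₀ hz0]
    rw [this, circleIntegral.integral_sub_inv_of_mem_ball (by simpa using hlt), smul_eq_mul,
      inv_mul_cancel₀ Complex.two_pi_I_ne_zero]
  · have hlt : ρ < ‖a‖ := lt_of_le_of_ne (not_lt.1 hlt) h
    rw [DiffContOnCl.circleAverage]
    · simp
    · refine DifferentiableOn.diffContOnCl_ball (U := Metric.closedBall 0 ρ) (fun z hz => ?_) (by rw [abs_of_pos hρ])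
      have : z - a ≠ 0 := by
        intro h0
        rw [sub_eq_zero.1 h0] at hz
        simp at hz
        linarith
      exact DifferentiableAt.differentiableWithinAt (by fun_prop (disch := assumption))

lemma circleAverage_re_div_sub {a : ℂ} {ρ : ℝ} (hρ : 0 < ρ) (h : ρ ≠ ‖a‖) :
    Real.circleAverage (fun z : ℂ => (z / (z - a)).re) 0 ρ = if ‖a‖ < ρ then 1 else 0 := by
  have := Complex.reCLM.circleAverage_comp_comm (circleIntegrable_div_sub hρ h)
  rw [circleAverage_div_sub hρ h] at this
  calc _ = _ := this
    _ = _ := by split_ifs <;> simp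

lemma inner_biotSavartKernel_complexPlane (z a : ℂ) :
    inner ℝ (biotSavartKernel (complexPlane z - complexPlane a)) (biotSavartKernel (complexPlane z)) =
      (4 * Real.pi ^ 2 * ‖z‖ ^ 2)⁻¹ * (z / (z - a)).re := by
  rw [inner_biotSavartKernel, ← map_sub, LinearIsometryEquiv.inner_map_map,
    LinearIsometryEquiv.norm_map, LinearIsometryEquiv.norm_map, Complex.div_re,
    Complex.inner, ← Complex.normSq_eq_norm_sq (z - a)]
  simp
  ring

lemma circleAverage_inner_kernel_sub {a b : ℂ} {ρ : ℝ} (hρ : 0 < ρ)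
    (h1 : ρ ≠ ‖a‖) (h2 : ρ ≠ ‖b‖) :
    Real.circleAverage (fun z => inner ℝ (biotSavartKernel (complexPlane z - complexPlane b) -
      biotSavartKernel (complexPlane z - complexPlane a)) (biotSavartKernel (complexPlane z))) 0 ρ =
    (4 * Real.pi ^ 2 * ρ ^ 2)⁻¹ * ((if ‖b‖ < ρ then 1 else 0) - (if ‖a‖ < ρ then 1 else 0)) := by
  rw [← circleAverage_re_div_sub hρ h1, ← circleAverage_re_div_sub hρ h2,
    ← Real.circleAverage_fun_sub
      (circleIntegrable_re_div_sub hρ h2) (circleIntegrable_re_div_sub hρ h1), ← smul_eq_mul,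
    ← Real.circleAverage_fun_smul]
  refine Real.circleAverage_congr_sphere fun z hz => ?_
  have : ‖z‖ = ρ := by simpa [abs_of_pos hρ] using hz
  simp only [inner_sub_left, inner_biotSavartKernel_complexPlane, this, smul_eq_mul]
  ring

lemma integral_Ioi_annulus {α β : ℝ} (hβ : 0 < β) (h : β ≤ α) :
    ∫ ρ in Ioi (0 : ℝ), ρ⁻¹ * ((if β < ρ then 1 else 0) - (if α < ρ then 1 else 0)) =
      Real.log α - Real.log β := by
  have : ∀ ρ : ℝ, ρ⁻¹ * ((if β < ρ then 1 else 0) - (if α < ρ then 1 else 0)) =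
      (Ioc β α).indicator (fun ρ => ρ⁻¹) ρ := by
    intro ρ
    by_cases h1 : β < ρ <;> by_cases h2 : α < ρ
    · simp [h1, h2]
    · simp [h1, h2, not_lt.1 h2]
    · linarith
    · simp [h1, h2]
  simp_rw [this]
  have hs : Ioc β α ⊆ Ioi 0 := fun x hx => hβ.trans hx.1
  rw [setIntegral_indicator measurableSet_Ioc, inter_eq_right.2 hs,
    ← intervalIntegral.integral_of_le h, integral_inv_of_pos hβ (hβ.trans_le h),
    Real.log_div (hβ.trans_le h).ne' hβ.ne']

lemma integral_Ioi_annulus' {α β : ℝ} (hα : 0 < α) (hβ : 0 < β) :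
    ∫ ρ in Ioi (0 : ℝ), ρ⁻¹ * ((if β < ρ then 1 else 0) - (if α < ρ then 1 else 0)) =
      Real.log α - Real.log β := by
  rcases le_total β α with h | h
  · exact integral_Ioi_annulus hβ h
  · rw [← neg_inj, ← integral_neg, neg_sub, ← integral_Ioi_annulus hα h]
    congr with ρ
    ring

/-- The two correlations diverge logarithmically at infinity when taken separately. In the
difference the circle averages cancel for ρ > max(|a|, |b|), and what remains is the integral of
1/(2πρ) between |a| and |b|. -/
lemma integral_inner_kernel_sub {a b : Plane} (ha : a ≠ 0) (hb : b ≠ 0)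
    (hi : Integrable fun x => inner ℝ (biotSavartKernel (x - b) - biotSavartKernel (x - a))
      (biotSavartKernel x)) :
    ∫ x, inner ℝ (biotSavartKernel (x - b) - biotSavartKernel (x - a)) (biotSavartKernel x) =
      (2 * Real.pi)⁻¹ * (Real.log ‖a‖ - Real.log ‖b‖) := by
  rw [integral_eq_circleAverage hi (Measurable.stronglyMeasurable (by fun_prop)),
    ← integral_Ioi_annulus' (norm_pos_iff.2 ha) (norm_pos_iff.2 hb), ← integral_const_mul]
  refine setIntegral_congr_ae measurableSet_Ioi ?_
  -- The circles through a or b, where the integrand has a pole, form a null set of radii.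
  have h1 : ∀ c : ℝ, ∀ᵐ ρ : ℝ, ρ ≠ c := fun c => by
    rw [ae_iff]; simp
  filter_upwards [h1 ‖a‖, h1 ‖b‖] with ρ hρa hρb hρ
  obtain ⟨a, rfl⟩ := complexPlane.surjective a
  obtain ⟨b, rfl⟩ := complexPlane.surjective b
  rw [LinearIsometryEquiv.norm_map] at hρa hρb
  rw [circleAverage_inner_kernel_sub hρ hρa hρb]
  simp only [LinearIsometryEquiv.norm_map, smul_eq_mul]
  have : ρ ≠ 0 := ne_of_gt hρ
  field_simp
  ring

/-- The increment of the Biot-Savart kernel. -/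
def kernelIncrement (h x : Plane) : Plane := biotSavartKernel (x + h) - biotSavartKernel x

lemma integral_inner_increment_kernel {h c : Plane} (hc : c ≠ 0) (hch : c ≠ h)
    (hi : Integrable fun x => inner ℝ (kernelIncrement h x) (biotSavartKernel (x + c))) :
    ∫ x, inner ℝ (kernelIncrement h x) (biotSavartKernel (x + c)) =
      (2 * Real.pi)⁻¹ * (Real.log ‖c‖ - Real.log ‖c - h‖) := by
  have e : ∀ x, inner ℝ (kernelIncrement h (x - c)) (biotSavartKernel (x - c + c)) =
      inner ℝ (biotSavartKernel (x - (c - h)) - biotSavartKernel (x - c)) (biotSavartKernel x) := by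
    intro x
    simp only [kernelIncrement, sub_add_cancel]
    congr 3
    abel_nf
  have hi' := hi.comp_sub_right c
  simp only [e] at hi'
  rw [← integral_sub_right_eq_self _ c]
  simp only [e]
  exact integral_inner_kernel_sub hc (sub_ne_zero.2 hch) hi'

/-- Applying the previous formula with c = w + h and c = w turns the correlation of increments into
a second difference of the logarithm. The two first differences stay bracketed because each is
averaged over h separately. -/
lemma integral_inner_increment_increment {h w : Plane} (hw : w ≠ 0) (h1 : w ≠ h) (h2 : w + h ≠ 0)
    (hi : ∀ c, c ≠ 0 → c ≠ h →
      Integrable fun x => inner ℝ (kernelIncrement h x) (biotSavartKernel (x + c))) :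
    ∫ x, inner ℝ (kernelIncrement h x) (kernelIncrement h (x + w)) =
      (2 * Real.pi)⁻¹ * ((Real.log ‖w + h‖ - Real.log ‖w‖) + (Real.log ‖w - h‖ - Real.log ‖w‖)) := by
  have h3 : w + h ≠ h := by simpa using hw
  have e : ∀ x, inner ℝ (kernelIncrement h x) (kernelIncrement h (x + w)) =
    inner ℝ (kernelIncrement h x) (biotSavartKernel (x + (w + h))) -
      inner ℝ (kernelIncrement h x) (biotSavartKernel (x + w)) := by
    intro x
    rw [← inner_sub_right, ← add_assoc]; rfl
  simp_rw [e]
  rw [integral_sub (hi _ h2 h3) (hi _ hw h1), integral_inner_increment_kernel h2 h3 (hi _ h2 h3),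
    integral_inner_increment_kernel hw h1 (hi _ hw h1), add_sub_cancel_right]
  ring

/-! ### Averages of the logarithm over balls. -/

lemma integrableOn_log_norm_add (w : Plane) (r : ℝ) :
    IntegrableOn (fun h => Real.log ‖w + h‖) (Metric.ball 0 r) := by
  have h1 : IntegrableOn (fun h : Plane => Real.log ‖h‖) (Metric.ball 0 (r + ‖w‖)) := by
    rw [integrableOn_fun_norm_addHaar volume (f := Real.log)]
    have : Continuous fun y : ℝ => y ^ (Module.finrank ℝ Plane - 1) • Real.log y := by
      simpa using Real.continuous_mul_log
    exact (this.integrableOn_Icc (a := 0) (b := r + ‖w‖)).mono_set Ioo_subset_Icc_self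
  rw [← integrable_indicator_iff measurableSet_ball] at h1 ⊢
  have h2 := (h1.comp_add_left w).indicator (measurableSet_ball (x := (0 : Plane)) (ε := r))
  refine h2.congr (.of_forall fun x => ?_)
  by_cases hx : x ∈ Metric.ball 0 r
  · have : w + x ∈ Metric.ball (0 : Plane) (r + ‖w‖) := by
      simp at hx ⊢
      linarith [norm_add_le w x]
    simp [hx, this]
  · simp [hx]

/-- Both sides equal log max(ρ, t) - log t; the left side is the shape in which the circle average
of the logarithm arrives. -/
lemma log_add_posLog_sub {ρ t : ℝ} (hρ : 0 < ρ) (ht : 0 < t) :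
    Real.log ρ + Real.posLog (ρ⁻¹ * t) - Real.log t = Real.posLog (ρ / t) := by
  have h1 : Real.log (ρ⁻¹ * t) = Real.log t - Real.log ρ := by
    rw [Real.log_mul (by positivity) ht.ne', Real.log_inv]; ring
  have h2 := Real.posLog_sub_posLog_inv (x := ρ⁻¹ * t)
  have h3 : (ρ⁻¹ * t)⁻¹ = ρ / t := by rw [mul_inv, inv_inv]; rfl
  rw [h3, h1] at h2
  linarith

/-- On |h| = ρ the average of log|w+h| - log|w| is log⁺(ρ/|w|) (Jensen). The result is a radial
integral of 2πρ log⁺(ρ/|w|), which is nonnegative and grows when ρ is replaced by r inside log⁺. -/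
lemma setIntegral_ball_log_norm_add {w : Plane} (hw : w ≠ 0) {r : ℝ} (hr : 0 < r) :
    (∫ h in Metric.ball (0 : Plane) r, (Real.log ‖w + h‖ - Real.log ‖w‖)) ∈
      Icc 0 (Real.pi * r ^ 2 * Real.posLog (r / ‖w‖)) := by
  have hi : IntegrableOn (fun h => Real.log ‖w + h‖ - Real.log ‖w‖) (Metric.ball 0 r) :=
    (integrableOn_log_norm_add w r).sub (integrableOn_const measure_ball_lt_top.ne)
  have hw' := norm_pos_iff.2 hw
  rw [← integrable_indicator_iff measurableSet_ball] at hi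
  rw [← integral_indicator measurableSet_ball, integral_eq_circleAverage hi
    ((Measurable.stronglyMeasurable (by fun_prop)).indicator measurableSet_ball)]
  have key : EqOn (fun ρ : ℝ => (2 * Real.pi * ρ) • Real.circleAverage (fun z =>
      (Metric.ball 0 r).indicator (fun h => Real.log ‖w + h‖ - Real.log ‖w‖) (complexPlane z)) 0 ρ)
      (fun ρ => (Iio r).indicator (fun ρ => 2 * Real.pi * ρ * Real.posLog (ρ / ‖w‖)) ρ) (Ioi 0) := by
    intro ρ hρ
    have hρ : 0 < ρ := hρ
    obtain ⟨w, rfl⟩ := complexPlane.surjective w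
    rw [LinearIsometryEquiv.norm_map] at hw'
    have hS : Real.circleAverage (fun z =>
      (Metric.ball 0 r).indicator (fun h => Real.log ‖complexPlane w + h‖ -
        Real.log ‖complexPlane w‖) (complexPlane z)) 0 ρ =
        Real.circleAverage (fun z => ((Iio r).indicator 1 ρ : ℝ) • (Real.log ‖z - -w‖ - Real.log ‖w‖)) 0 ρ := by
      refine Real.circleAverage_congr_sphere fun z hz => ?_
      have : ‖z‖ = ρ := by simpa [abs_of_pos hρ] using hz
      by_cases h : ρ < r <;>
        simp [h, this, ← map_add, add_comm]
    dsimp only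
    rw [hS, Real.circleAverage_fun_smul, Real.circleAverage_fun_sub _ (circleIntegrable_const _ _ _),
      circleAverage_log_norm_sub_const_eq_log_radius_add_posLog hρ.ne', Real.circleAverage_const,
      sub_neg_eq_add, zero_add, log_add_posLog_sub hρ hw', LinearIsometryEquiv.norm_map]
    · by_cases h : ρ < r <;> simp [h]
    · exact MeromorphicOn.circleIntegrable_log_norm (fun _ _ ↦ by fun_prop)
  rw [setIntegral_congr_fun measurableSet_Ioi key, setIntegral_indicator measurableSet_Iio,
    Ioi_inter_Iio]
  have hv : ∫ ρ in Ioo 0 r, 2 * Real.pi * ρ * Real.posLog (r / ‖w‖) =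
      Real.pi * r ^ 2 * Real.posLog (r / ‖w‖) := by
    rw [← integral_Ioc_eq_integral_Ioo, ← intervalIntegral.integral_of_le hr.le]
    simp only [mul_assoc, intervalIntegral.integral_const_mul, intervalIntegral.integral_mul_const,
      integral_id]
    ring
  refine ⟨setIntegral_nonneg measurableSet_Ioo fun ρ hρ => ?_, ?_⟩
  · have := hρ.1; have := Real.posLog_nonneg (x := ρ / ‖w‖); positivity
  · rw [← hv]
    refine setIntegral_mono_on ?_ ?_ measurableSet_Ioo fun ρ hρ => ?_
    · refine (Continuous.integrableOn_Icc ?_).mono_set Ioo_subset_Icc_self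
      have := Real.continuous_posLog
      fun_prop
    · exact (Continuous.integrableOn_Icc (by fun_prop)).mono_set Ioo_subset_Icc_self
    · have := hρ.1
      refine mul_le_mul_of_nonneg_left ?_ (by positivity)
      exact Real.posLog_le_posLog (by positivity) (div_le_div_of_nonneg_right hρ.2.le hw'.le)

lemma setIntegral_ball_log_norm_sub {w : Plane} (hw : w ≠ 0) {r : ℝ} (hr : 0 < r) :
    (∫ h in Metric.ball (0 : Plane) r, (Real.log ‖w - h‖ - Real.log ‖w‖)) ∈
      Icc 0 (Real.pi * r ^ 2 * Real.posLog (r / ‖w‖)) := by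
  have : (∫ h in Metric.ball (0 : Plane) r, (Real.log ‖w - h‖ - Real.log ‖w‖)) =
      ∫ h in Metric.ball (0 : Plane) r, (Real.log ‖w + h‖ - Real.log ‖w‖) := by
    rw [← integral_indicator measurableSet_ball, ← integral_indicator measurableSet_ball,
      ← integral_neg_eq_self]
    congr with x
    simp [indicator]
  rw [this]
  exact setIntegral_ball_log_norm_add hw hr

/-! ### Pointwise majorants and overlap of singularities. -/

/-- The singular part `1_{|x| < 1} / |x|` of the kernel size (infinite at the origin). -/
def singularPart (x : Plane) : ℝ≥0∞ := (Metric.ball 0 1).indicator (fun x => (ENNReal.ofReal ‖x‖)⁻¹) x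

/-- The weight `(1 + |x|)⁻¹`. -/
def decayWeight (x : Plane) : ℝ≥0∞ := ENNReal.ofReal (1 + ‖x‖)⁻¹

/-- The truncated logarithm `log⁺ (r / |w|)`, as the integral of `1_{|w| ≤ s} / s` over `(0, r]`. -/
def truncatedLog (r : ℝ) (w : Plane) : ℝ≥0∞ :=
  ∫⁻ s in Ioc 0 r, if ‖w‖ ≤ s then (ENNReal.ofReal s)⁻¹ else 0

@[fun_prop]
lemma measurable_singularPart : Measurable singularPart :=
  Measurable.indicator (by fun_prop) measurableSet_ball

@[fun_prop]
lemma measurable_decayWeight : Measurable decayWeight := by unfold decayWeight; fun_prop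

lemma measurable_truncatedLog_integrand :
    Measurable fun p : Plane × ℝ => if ‖p.1‖ ≤ p.2 then (ENNReal.ofReal p.2)⁻¹ else 0 :=
  Measurable.ite (measurableSet_le (by fun_prop) (by fun_prop)) (by fun_prop) measurable_const

@[fun_prop]
lemma measurable_truncatedLog (r : ℝ) : Measurable (truncatedLog r) :=
  measurable_truncatedLog_integrand.lintegral_prod_right'

lemma singularPart_zero : singularPart 0 = ∞ := by simp [singularPart]

lemma singularPart_of_lt {x : Plane} (hx : x ≠ 0) (h : ‖x‖ < 1) :
    singularPart x = ENNReal.ofReal ‖x‖⁻¹ := by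
  rw [singularPart, indicator_of_mem (by simpa using h), ENNReal.ofReal_inv_of_pos (norm_pos_iff.2 hx)]

lemma decayWeight_le_one (x : Plane) : decayWeight x ≤ 1 := by
  rw [decayWeight, ← ENNReal.ofReal_one]
  exact ENNReal.ofReal_le_ofReal (inv_le_one_of_one_le₀ (by linarith [norm_nonneg x]))

lemma lintegral_singularPart_lt_top : ∫⁻ x, singularPart x < ∞ := by
  have h : ∀ x : Plane, singularPart x = (fun t => (Iio (1 : ℝ)).indicator (fun t => (ENNReal.ofReal t)⁻¹) t) ‖x‖ := by
    intro x
    simp [singularPart, indicator]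
  simp_rw [h]
  rw [lintegral_radial (Measurable.indicator (by fun_prop) measurableSet_Iio)]
  refine ENNReal.mul_lt_top ENNReal.ofReal_lt_top (lt_of_le_of_lt (lintegral_mono
    (g := (Iio (1 : ℝ)).indicator 1) fun t => ?_) ?_)
  · by_cases ht : t < 1 <;> simp [ht, ENNReal.mul_inv_le_one]
  · rw [lintegral_indicator_one measurableSet_Iio, Measure.restrict_apply measurableSet_Iio]
    refine lt_of_le_of_lt (measure_mono (t := Ioo 0 1) fun x hx => ⟨hx.2, hx.1⟩) (by simp)

lemma lintegral_decayWeight_pow_lt_top {n : ℕ} (hn : 3 ≤ n) : ∫⁻ x, decayWeight x ^ n < ∞ := by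
  have h : Integrable fun x : Plane => (1 + ‖x‖) ^ (-(3 : ℝ)) :=
    integrable_one_add_norm (by simp; norm_num)
  refine lt_of_le_of_lt (lintegral_mono fun x => ?_) h.lintegral_lt_top
  calc decayWeight x ^ n ≤ decayWeight x ^ 3 := pow_le_pow_right_of_le_one' (decayWeight_le_one x) hn
    _ = _ := by
      rw [decayWeight, ← ENNReal.ofReal_pow (by positivity), Real.rpow_neg (by positivity), inv_pow]
      norm_cast

lemma enorm_biotSavartKernel_le (x : Plane) :
    ‖biotSavartKernel x‖ₑ ≤ singularPart x + 2 * decayWeight x := by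
  rcases eq_or_ne x 0 with rfl | hx
  · simp [singularPart_zero]
  have hx' := norm_pos_iff.2 hx
  have h1 : ‖biotSavartKernel x‖ ≤ ‖x‖⁻¹ := by
    rw [norm_biotSavartKernel]
    gcongr
    nlinarith [Real.two_le_pi]
  rw [← ofReal_norm]
  by_cases h : ‖x‖ < 1
  · rw [singularPart_of_lt hx h]
    exact le_add_right (ENNReal.ofReal_le_ofReal h1)
  · refine le_add_left ((ENNReal.ofReal_le_ofReal h1).trans ?_)
    have : ‖x‖⁻¹ ≤ 2 * (1 + ‖x‖)⁻¹ := by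
      push Not at h
      rw [← div_eq_mul_inv, inv_eq_one_div, div_le_div_iff₀ hx' (by positivity)]
      linarith
    refine (ENNReal.ofReal_le_ofReal this).trans ?_
    rw [ENNReal.ofReal_mul (by norm_num), decayWeight]
    simp

@[fun_prop]
lemma measurable_kernelIncrement (h : Plane) : Measurable (kernelIncrement h) := by
  unfold kernelIncrement; fun_prop

/-- The inversion formula gives |D_hK(x)| ≤ |h|/(|x||x+h|). Near both poles, |h| ≤ |x| + |x+h|
splits the product into a sum; near one pole the other factor is at most 1; away from both the bound
is quadratic decay. At the poles the right side is infinite, so no point is excluded. -/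
lemma enorm_kernelIncrement_le {r : ℝ} (hr : 0 ≤ r) {h : Plane} (hh : ‖h‖ ≤ r) (x : Plane) :
    ‖kernelIncrement h x‖ₑ ≤ ENNReal.ofReal (4 * (1 + r) ^ 2) *
      (singularPart x + singularPart (x + h) + decayWeight x ^ 2) := by
  have hC : ENNReal.ofReal (4 * (1 + r) ^ 2) ≠ 0 := by
    simp only [ne_eq, ENNReal.ofReal_eq_zero, not_le]; positivity
  rcases eq_or_ne x 0 with rfl | hx
  · rw [singularPart_zero, top_add, top_add, ENNReal.mul_top hC]
    exact le_top
  rcases eq_or_ne (x + h) 0 with hxh | hxh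
  · rw [hxh, singularPart_zero, add_top, top_add, ENNReal.mul_top hC]
    exact le_top
  have hx' := norm_pos_iff.2 hx
  have hxh' := norm_pos_iff.2 hxh
  have h0 : ‖kernelIncrement h x‖ ≤ ‖h‖ * (‖x‖⁻¹ * ‖x + h‖⁻¹) := by
    rw [kernelIncrement, norm_biotSavartKernel_sub hxh hx, add_sub_cancel_left, div_eq_mul_inv,
      ← mul_inv]
    refine mul_le_mul_of_nonneg_left (inv_anti₀ (by positivity) ?_) (norm_nonneg h)
    nlinarith [Real.two_le_pi, mul_pos hx' hxh']
  have hC1 : 1 ≤ 4 * (1 + r) ^ 2 := by nlinarith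
  have hCr : r ≤ 4 * (1 + r) ^ 2 := by nlinarith
  have tri : ‖h‖ ≤ ‖x‖ + ‖x + h‖ := by
    have := norm_sub_le (x + h) x
    rw [add_sub_cancel_left] at this; linarith
  have tri2 : ‖x + h‖ ≤ ‖x‖ + ‖h‖ := norm_add_le _ _
  have tri3 : ‖x‖ ≤ ‖x + h‖ + ‖h‖ := by
    have := norm_sub_le (x + h) h
    rwa [add_sub_cancel_right] at this
  rw [← ofReal_norm]
  by_cases h1 : ‖x‖ < 1 <;> by_cases h2 : ‖x + h‖ < 1
  · rw [singularPart_of_lt hx h1, singularPart_of_lt hxh h2, mul_add]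
    refine le_add_right ?_
    rw [← ENNReal.ofReal_add (by positivity) (by positivity), ← ENNReal.ofReal_mul (by positivity)]
    refine ENNReal.ofReal_le_ofReal (h0.trans ?_)
    calc ‖h‖ * (‖x‖⁻¹ * ‖x + h‖⁻¹) ≤ (‖x‖ + ‖x + h‖) * (‖x‖⁻¹ * ‖x + h‖⁻¹) := by gcongr
      _ = 1 * (‖x‖⁻¹ + ‖x + h‖⁻¹) := by field_simp; ring
      _ ≤ _ := by gcongr
  · rw [singularPart_of_lt hx h1, mul_add, mul_add]
    refine le_add_right (le_add_right ?_)
    rw [← ENNReal.ofReal_mul (by positivity)]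
    refine ENNReal.ofReal_le_ofReal (h0.trans ?_)
    have : ‖x + h‖⁻¹ ≤ 1 := inv_le_one_of_one_le₀ (not_lt.1 h2)
    calc ‖h‖ * (‖x‖⁻¹ * ‖x + h‖⁻¹) ≤ r * (‖x‖⁻¹ * 1) := by gcongr
      _ ≤ _ := by rw [mul_one]; gcongr
  · rw [singularPart_of_lt hxh h2, mul_add, mul_add]
    refine le_add_right (le_add_left ?_)
    rw [← ENNReal.ofReal_mul (by positivity)]
    refine ENNReal.ofReal_le_ofReal (h0.trans ?_)
    have : ‖x‖⁻¹ ≤ 1 := inv_le_one_of_one_le₀ (not_lt.1 h1)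
    calc ‖h‖ * (‖x‖⁻¹ * ‖x + h‖⁻¹) ≤ r * (1 * ‖x + h‖⁻¹) := by gcongr
      _ ≤ _ := by rw [one_mul]; gcongr
  · push Not at h1 h2
    rw [mul_add]
    refine le_add_left ?_
    rw [decayWeight, ← ENNReal.ofReal_pow (by positivity), ← ENNReal.ofReal_mul (by positivity)]
    refine ENNReal.ofReal_le_ofReal (h0.trans ?_)
    have e1 : ‖x‖⁻¹ ≤ 2 * (1 + ‖x‖)⁻¹ := by
      rw [← div_eq_mul_inv, inv_eq_one_div, div_le_div_iff₀ hx' (by positivity)]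
      linarith
    -- Here 1 + |x| ≤ (1 + r) + |x+h| ≤ 2(1 + r)|x+h|, as |x+h| ≥ 1.
    have e2 : ‖x + h‖⁻¹ ≤ 2 * (1 + r) * (1 + ‖x‖)⁻¹ := by
      rw [← div_eq_mul_inv, inv_eq_one_div, div_le_div_iff₀ hxh' (by positivity)]
      nlinarith
    calc ‖h‖ * (‖x‖⁻¹ * ‖x + h‖⁻¹)
        ≤ (1 + r) * ((2 * (1 + ‖x‖)⁻¹) * (2 * (1 + r) * (1 + ‖x‖)⁻¹)) := by
          gcongr
          linarith
      _ = _ := by ring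

/-- The larger of |x| and |x+w| is at least |w|/2, so its inverse is at most 2/max(t, |w|) with t
the smaller one. The two summands cover the two orderings. -/
lemma singularPart_mul_le (x w : Plane) : singularPart x * singularPart (x + w) ≤
    (Iio 1).indicator (fun t => (ENNReal.ofReal t)⁻¹ * (2 * (ENNReal.ofReal (max t ‖w‖))⁻¹)) ‖x‖ +
    (Iio 1).indicator (fun t => (ENNReal.ofReal t)⁻¹ * (2 * (ENNReal.ofReal (max t ‖w‖))⁻¹))
      ‖x + w‖ := by
  by_cases h1 : ‖x‖ < 1
  swap
  · simp [singularPart, h1]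
  by_cases h2 : ‖x + w‖ < 1
  swap
  · simp [singularPart, h2]
  have key : ∀ a m : ℝ, m ≤ 2 * a → (ENNReal.ofReal a)⁻¹ ≤ 2 * (ENNReal.ofReal m)⁻¹ := by
    intro a m h
    rw [ENNReal.inv_le_iff_inv_le, ENNReal.mul_inv (by simp) (by simp), inv_inv]
    calc 2⁻¹ * ENNReal.ofReal m ≤ 2⁻¹ * ENNReal.ofReal (2 * a) := by gcongr
      _ = ENNReal.ofReal a := by
        rw [ENNReal.ofReal_mul (by norm_num), ← mul_assoc]
        simp [ENNReal.inv_mul_cancel]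
  have tri : ‖w‖ ≤ ‖x‖ + ‖x + w‖ := by
    have := norm_sub_le (x + w) x
    rw [add_sub_cancel_left] at this; linarith
  simp only [singularPart, mem_ball_zero_iff, h1, h2, indicator_of_mem, mem_Iio]
  rcases le_total ‖x‖ ‖x + w‖ with h | h
  · refine le_add_right (mul_le_mul_right (key _ _ (max_le ?_ ?_)) _)
    · linarith [norm_nonneg x]
    · linarith
  · refine le_add_left ?_
    rw [mul_comm]
    refine mul_le_mul_right (key _ _ (max_le ?_ ?_)) _
    · linarith [norm_nonneg (x + w)]
    · linarith

lemma lintegral_inv_max_le (c : ℝ) : ∫⁻ t in Ioo 0 1, (ENNReal.ofReal (max t c))⁻¹ ≤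
    1 + ∫⁻ s in Ioc 0 1, if c ≤ s then (ENNReal.ofReal s)⁻¹ else 0 := by
  have h : ∀ t : ℝ, (ENNReal.ofReal (max t c))⁻¹ ≤
      (Iio c).indicator (fun _ => (ENNReal.ofReal c)⁻¹) t +
        if c ≤ t then (ENNReal.ofReal t)⁻¹ else 0 := by
    intro t
    by_cases ht : c ≤ t
    · simp [ht, not_lt.2 ht]
    · simp [ht, not_le.1 ht, (not_le.1 ht).le]
  refine (lintegral_mono h).trans ?_
  rw [lintegral_add_left (measurable_const.indicator measurableSet_Iio)]
  refine add_le_add ?_ (lintegral_mono_set Ioo_subset_Ioc_self)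
  rw [lintegral_indicator_const measurableSet_Iio, Measure.restrict_apply measurableSet_Iio]
  calc _ ≤ (ENNReal.ofReal c)⁻¹ * volume (Ioo 0 c) := by
        gcongr
        exact fun x hx => ⟨hx.2.1, hx.1⟩
    _ ≤ 1 := by simp [ENNReal.inv_mul_le_one]

/-- The polar Jacobian cancels one factor 1/t and leaves the integral of 1/max(t, |w|): two
order-one singularities at distance |w| overlap only logarithmically. -/
lemma lintegral_singularPart_mul_le (w : Plane) : ∫⁻ x, singularPart x * singularPart (x + w) ≤
    ENNReal.ofReal (8 * Real.pi) * (1 + truncatedLog 1 w) := by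
  set g : ℝ → ℝ≥0∞ := (Iio 1).indicator fun t =>
    (ENNReal.ofReal t)⁻¹ * (2 * (ENNReal.ofReal (max t ‖w‖))⁻¹) with hg
  have hgm : Measurable g := Measurable.indicator (by fun_prop) measurableSet_Iio
  have hle : ∀ x, singularPart x * singularPart (x + w) ≤ g ‖x‖ + g ‖x + w‖ :=
    fun x => singularPart_mul_le x w
  refine (lintegral_mono hle).trans ?_
  have hgm' : Measurable fun x : Plane => g ‖x‖ := hgm.comp measurable_norm
  rw [lintegral_add_left hgm', lintegral_add_right_eq_self (fun x : Plane => g ‖x‖),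
    lintegral_radial hgm, ← two_mul]
  have h1 : ∫⁻ ρ in Ioi 0, ENNReal.ofReal ρ * g ρ ≤ 2 * (1 + truncatedLog 1 w) := by
    calc _ ≤ ∫⁻ ρ in Ioi 0, (Iio 1).indicator (fun t => 2 * (ENNReal.ofReal (max t ‖w‖))⁻¹) ρ := by
          refine lintegral_mono fun ρ => ?_
          by_cases h : ρ < 1
          · simp only [hg, indicator_of_mem (mem_Iio.2 h), ← mul_assoc]
            gcongr
            exact mul_le_of_le_one_left' (ENNReal.mul_inv_le_one _)
          · simp [hg, h]
      _ = 2 * ∫⁻ t in Ioo 0 1, (ENNReal.ofReal (max t ‖w‖))⁻¹ := by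
          rw [lintegral_indicator measurableSet_Iio, Measure.restrict_restrict measurableSet_Iio,
            lintegral_const_mul _ (by fun_prop), inter_comm, Ioi_inter_Iio]
      _ ≤ _ := by gcongr; exact lintegral_inv_max_le _
  calc _ ≤ 2 * (ENNReal.ofReal (2 * Real.pi) * (2 * (1 + truncatedLog 1 w))) := by gcongr
    _ = _ := by
      rw [show (8 : ℝ) * Real.pi = 2 * (2 * Real.pi) * 2 by ring,
        ENNReal.ofReal_mul (by positivity), ENNReal.ofReal_mul (by positivity)]
      simp [mul_assoc]

lemma truncatedLog_lt_top (r : ℝ) {w : Plane} (hw : w ≠ 0) : truncatedLog r w < ∞ := by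
  have hw' := norm_pos_iff.2 hw
  refine lt_of_le_of_lt (lintegral_mono (g := fun _ => (ENNReal.ofReal ‖w‖)⁻¹) fun s => ?_) ?_
  · by_cases h : ‖w‖ ≤ s
    · simp only [h, if_true]
      gcongr
    · simp [h]
  · simp only [lintegral_const, Measure.restrict_apply_univ]
    exact ENNReal.mul_lt_top (by simpa using hw) (by simp)

lemma ofReal_posLog_le_truncatedLog {r : ℝ} (hr : 0 < r) {w : Plane} (hw : w ≠ 0) :
    ENNReal.ofReal (Real.posLog (r / ‖w‖)) ≤ truncatedLog r w := by
  have hw' := norm_pos_iff.2 hw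
  rcases le_total r ‖w‖ with h | h
  · have : Real.posLog (r / ‖w‖) = 0 := by
      rw [Real.posLog_eq_zero_iff, abs_of_pos (by positivity)]
      exact (div_le_one hw').2 h
    simp [this]
  · have h1 : Real.posLog (r / ‖w‖) = ∫ s in Ioc ‖w‖ r, s⁻¹ := by
      rw [Real.posLog_eq_log, ← intervalIntegral.integral_of_le h, integral_inv_of_pos hw' hr]
      rw [abs_of_pos (by positivity)]
      exact (one_le_div hw').2 h
    have h2 : IntegrableOn (fun s : ℝ => s⁻¹) (Ioc ‖w‖ r) := by
      refine (ContinuousOn.integrableOn_Icc fun x hx => ?_).mono_set Ioc_subset_Icc_self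
      have : x ≠ 0 := (hw'.trans_le hx.1).ne'
      exact ContinuousAt.continuousWithinAt (by fun_prop (disch := assumption))
    rw [h1, ofReal_integral_eq_lintegral_ofReal h2]
    · calc ∫⁻ s in Ioc ‖w‖ r, ENNReal.ofReal s⁻¹ ≤
          ∫⁻ s in Ioc ‖w‖ r, if ‖w‖ ≤ s then (ENNReal.ofReal s)⁻¹ else 0 := by
            refine setLIntegral_mono' measurableSet_Ioc fun s hs => ?_
            rw [if_pos hs.1.le, ENNReal.ofReal_inv_of_pos (hw'.trans hs.1)]
        _ ≤ _ := lintegral_mono_set (Ioc_subset_Ioc_left hw'.le)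
    · filter_upwards [ae_restrict_mem measurableSet_Ioc] with s hs
      exact inv_nonneg.2 (hw'.trans hs.1).le

/-! ### Logarithmic energy and absolute convergence bounds. -/

/-- Exchanging the s- and z-integrals turns the inner integral into that of μ(B̄_s(y))/s. This is
where the maximal function enters. -/
lemma lintegral_truncatedLog_le (μ : Measure Plane) [IsFiniteMeasure μ] {M : ℝ → ℝ≥0∞}
    (hM : ∀ z s, μ (Metric.closedBall z s) ≤ M s) (r : ℝ) :
    ∫⁻ y, ∫⁻ z, truncatedLog r (y - z) ∂μ ∂μ ≤ μ univ * ∫⁻ s in Ioc 0 r, M s / ENNReal.ofReal s := by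
  have h : ∀ y, ∫⁻ z, truncatedLog r (y - z) ∂μ ≤ ∫⁻ s in Ioc 0 r, M s / ENNReal.ofReal s := by
    intro y
    unfold truncatedLog
    rw [lintegral_lintegral_swap]
    · refine lintegral_mono fun s => ?_
      have : (fun z => if ‖y - z‖ ≤ s then (ENNReal.ofReal s)⁻¹ else 0) =
          (Metric.closedBall y s).indicator fun _ => (ENNReal.ofReal s)⁻¹ := by
        ext z
        simp [indicator, dist_comm z y, dist_eq_norm]
      dsimp only
      rw [this, lintegral_indicator_const measurableSet_closedBall, mul_comm, ENNReal.div_eq_inv_mul,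
        mul_comm]
      gcongr
      exact hM _ _
    · exact (measurable_truncatedLog_integrand.comp
        (f := fun p : Plane × ℝ => (y - p.1, p.2)) (by fun_prop)).aemeasurable
  refine (lintegral_mono h).trans ?_
  simp [mul_comm]

/-- The square is a double integral in y and z; after Tonelli, translation by y leaves a dependence
on y - z alone. -/
lemma lintegral_convolution_sq (μ : Measure Plane) [IsFiniteMeasure μ] {f : Plane → ℝ≥0∞}
    (hf : Measurable f) : ∫⁻ x, (∫⁻ y, f (x - y) ∂μ) ^ 2 =
      ∫⁻ y, ∫⁻ z, ∫⁻ x, f x * f (x + (y - z)) ∂volume ∂μ ∂μ := by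
  have h : ∀ x, (∫⁻ y, f (x - y) ∂μ) ^ 2 = ∫⁻ y, ∫⁻ z, f (x - y) * f (x - z) ∂μ ∂μ := by
    intro x
    rw [sq, ← lintegral_mul_const _ (by fun_prop)]
    congr with y
    rw [lintegral_const_mul _ (by fun_prop)]
  simp_rw [h]
  rw [lintegral_lintegral_swap]
  · refine lintegral_congr fun y => ?_
    rw [lintegral_lintegral_swap (by fun_prop)]
    refine lintegral_congr fun z => ?_
    rw [← lintegral_sub_right_eq_self (fun x => f x * f (x + (y - z))) y]
    refine lintegral_congr fun x => ?_
    have : x - y + (y - z) = x - z := by abel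
    rw [this]
  · exact (Measurable.lintegral_prod_right' (f := fun q : (Plane × Plane) × Plane =>
      f (q.1.1 - q.1.2) * f (q.1.1 - q.2)) (by fun_prop)).aemeasurable

lemma lintegral_singularPart_convolution_sq_lt_top (μ : Measure Plane) [IsFiniteMeasure μ]
    (hμ : ∫⁻ y, ∫⁻ z, truncatedLog 1 (y - z) ∂μ ∂μ < ∞) :
    ∫⁻ x, (∫⁻ y, singularPart (x - y) ∂μ) ^ 2 < ∞ := by
  rw [lintegral_convolution_sq μ measurable_singularPart]
  refine lt_of_le_of_lt (lintegral_mono fun y => lintegral_mono fun z =>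
    lintegral_singularPart_mul_le _) ?_
  have : ∀ y, ∫⁻ z, ENNReal.ofReal (8 * Real.pi) * (1 + truncatedLog 1 (y - z)) ∂μ =
      ENNReal.ofReal (8 * Real.pi) * (μ univ + ∫⁻ z, truncatedLog 1 (y - z) ∂μ) := by
    intro y
    rw [lintegral_const_mul _ (by fun_prop), lintegral_add_left (by fun_prop)]
    simp
  simp_rw [this]
  rw [lintegral_const_mul', lintegral_add_left (by fun_prop), lintegral_const]
  · exact ENNReal.mul_lt_top ENNReal.ofReal_lt_top (ENNReal.add_lt_top.2
      ⟨ENNReal.mul_lt_top (measure_lt_top _ _) (measure_lt_top _ _), hμ⟩)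
  · exact ENNReal.ofReal_ne_top

lemma lintegral_decayWeight_convolution_sq_lt_top (μ : Measure Plane) [IsFiniteMeasure μ] :
    ∫⁻ x, (∫⁻ y, decayWeight (x - y) ^ 2 ∂μ) ^ 2 < ∞ := by
  rw [lintegral_convolution_sq μ (f := fun x => decayWeight x ^ 2) (by fun_prop)]
  have h : ∀ a b : ℝ≥0∞, a ^ 2 * b ^ 2 ≤ a ^ 4 + b ^ 4 := by
    intro a b
    rcases le_total a b with h | h
    · refine le_add_left ?_
      calc a ^ 2 * b ^ 2 ≤ b ^ 2 * b ^ 2 := by gcongr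
        _ = b ^ 4 := by ring
    · refine le_add_right ?_
      calc a ^ 2 * b ^ 2 ≤ a ^ 2 * a ^ 2 := by gcongr
        _ = a ^ 4 := by ring
  have h2 : ∀ w, ∫⁻ x, decayWeight x ^ 2 * decayWeight (x + w) ^ 2 ≤
      2 * ∫⁻ x, decayWeight x ^ 4 := by
    intro w
    refine (lintegral_mono fun x => h _ _).trans ?_
    rw [lintegral_add_left (by fun_prop),
      lintegral_add_right_eq_self (fun x : Plane => decayWeight x ^ 4), two_mul]
  refine lt_of_le_of_lt (lintegral_mono fun y => lintegral_mono fun z => h2 _) ?_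
  simp only [lintegral_const]
  have := lintegral_decayWeight_pow_lt_top (n := 4) (by norm_num)
  have := measure_lt_top μ univ
  exact ENNReal.mul_lt_top (ENNReal.mul_lt_top (ENNReal.mul_lt_top (by simp) ‹_›) ‹_›) ‹_›

lemma add_add_sq_le (a b c : ℝ≥0∞) : (a + b + c) ^ 2 ≤ 9 * (a ^ 2 + b ^ 2 + c ^ 2) := by
  have h : ∀ m, m = a ∨ m = b ∨ m = c → a ≤ m → b ≤ m → c ≤ m →
      (a + b + c) ^ 2 ≤ 9 * (a ^ 2 + b ^ 2 + c ^ 2) := by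
    intro m hm h1 h2 h3
    calc (a + b + c) ^ 2 ≤ (m + m + m) ^ 2 := by gcongr
      _ = 9 * m ^ 2 := by ring
      _ ≤ _ := by
        gcongr
        rcases hm with rfl | rfl | rfl
        · exact le_add_right (le_add_right le_rfl)
        · exact le_add_right (le_add_left le_rfl)
        · exact le_add_left le_rfl
  refine h (max a (max b c)) ?_ (by simp) (by simp) (by simp)
  rcases max_choice a (max b c) with h1 | h1
  · exact Or.inl h1
  · rw [h1]
    exact Or.inr (max_choice b c)

/-- Only finiteness, uniform in |h| ≤ r, matters: it licenses Fubini. The sharp estimate comes later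
from the exact formula. -/
lemma exists_lintegral_increment_convolution_sq_le (μ : Measure Plane) [IsFiniteMeasure μ]
    (hμ : ∫⁻ y, ∫⁻ z, truncatedLog 1 (y - z) ∂μ ∂μ < ∞) {r : ℝ} (hr : 0 ≤ r) :
    ∃ C < ∞, ∀ h : Plane, ‖h‖ ≤ r →
      ∫⁻ x, (∫⁻ y, ‖kernelIncrement h (x - y)‖ₑ ∂μ) ^ 2 ≤ C := by
  set A := ∫⁻ x, (∫⁻ y, singularPart (x - y) ∂μ) ^ 2 with hA
  set B := ∫⁻ x, (∫⁻ y, decayWeight (x - y) ^ 2 ∂μ) ^ 2 with hB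
  have hA' : A < ∞ := lintegral_singularPart_convolution_sq_lt_top μ hμ
  have hB' : B < ∞ := lintegral_decayWeight_convolution_sq_lt_top μ
  set c := ENNReal.ofReal (4 * (1 + r) ^ 2) with hc
  have hm1 : Measurable fun x => (∫⁻ y, singularPart (x - y) ∂μ) :=
    Measurable.lintegral_prod_right' (f := fun q : Plane × Plane => singularPart (q.1 - q.2))
      (by fun_prop)
  have hm2 : Measurable fun x => (∫⁻ y, decayWeight (x - y) ^ 2 ∂μ) :=
    Measurable.lintegral_prod_right' (f := fun q : Plane × Plane => decayWeight (q.1 - q.2) ^ 2)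
      (by fun_prop)
  refine ⟨c ^ 2 * (9 * (A + A + B)), ?_, fun h hh => ?_⟩
  · refine ENNReal.mul_lt_top (ENNReal.pow_lt_top ENNReal.ofReal_lt_top) (ENNReal.mul_lt_top (by simp) ?_)
    exact ENNReal.add_lt_top.2 ⟨ENNReal.add_lt_top.2 ⟨hA', hA'⟩, hB'⟩
  calc ∫⁻ x, (∫⁻ y, ‖kernelIncrement h (x - y)‖ₑ ∂μ) ^ 2
      ≤ ∫⁻ x, c ^ 2 * (9 * ((∫⁻ y, singularPart (x - y) ∂μ) ^ 2 +
          (∫⁻ y, singularPart ((x + h) - y) ∂μ) ^ 2 + (∫⁻ y, decayWeight (x - y) ^ 2 ∂μ) ^ 2)) := by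
        refine lintegral_mono fun x => ?_
        refine le_trans ?_ (mul_le_mul_right (add_add_sq_le _ _ _) _)
        rw [← mul_pow]
        gcongr
        refine (lintegral_mono fun y => enorm_kernelIncrement_le hr hh _).trans (le_of_eq ?_)
        rw [lintegral_const_mul _ (by fun_prop), lintegral_add_left (by fun_prop),
          lintegral_add_left (by fun_prop)]
        simp only [sub_add_eq_add_sub]
        rfl
    _ = c ^ 2 * (9 * (A + A + B)) := by
        rw [lintegral_const_mul _ (by fun_prop), lintegral_const_mul _ (by fun_prop),
          lintegral_add_left (by fun_prop), lintegral_add_left (by fun_prop),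
          lintegral_add_right_eq_self (fun x => (∫⁻ y, singularPart (x - y) ∂μ) ^ 2)]

/-- The conditions on c keep the pole -c of the second factor away from the poles 0 and -h of the
increment. At infinity the product decays like |x|⁻³, whence the cubes of the weight. -/
lemma integrable_inner_increment_kernel {h c : Plane} (hc : c ≠ 0) (hch : c ≠ h) :
    Integrable fun x => inner ℝ (kernelIncrement h x) (biotSavartKernel (x + c)) := by
  refine ⟨Measurable.aestronglyMeasurable (by fun_prop), ?_⟩
  set C := ENNReal.ofReal (4 * (1 + ‖h‖) ^ 2) with hC
  have hb : ∀ a b : ℝ≥0∞, a ^ 2 * b ≤ a ^ 3 + b ^ 3 := by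
    intro a b
    rcases le_total a b with h | h
    · refine le_add_left ?_
      calc a ^ 2 * b ≤ b ^ 2 * b := by gcongr
        _ = b ^ 3 := by ring
    · refine le_add_right ?_
      calc a ^ 2 * b ≤ a ^ 2 * a := by gcongr
        _ = a ^ 3 := by ring
  have hbound : ∀ x, ‖inner ℝ (kernelIncrement h x) (biotSavartKernel (x + c))‖ₑ ≤
      C * (singularPart x * singularPart (x + c) + 2 * singularPart x +
        (singularPart (x + h) * singularPart (x + h + (c - h)) + 2 * singularPart (x + h)) +
        (singularPart (x + c) + 2 * (decayWeight x ^ 3 + decayWeight (x + c) ^ 3))) := by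
    intro x
    have h1 : ‖inner ℝ (kernelIncrement h x) (biotSavartKernel (x + c))‖ₑ ≤
        ‖kernelIncrement h x‖ₑ * ‖biotSavartKernel (x + c)‖ₑ := by
      simp only [← ofReal_norm]
      rw [← ENNReal.ofReal_mul (norm_nonneg _)]
      exact ENNReal.ofReal_le_ofReal (norm_inner_le_norm _ _)
    refine h1.trans ((mul_le_mul' (enorm_kernelIncrement_le (norm_nonneg h) le_rfl x)
      (enorm_biotSavartKernel_le _)).trans ?_)
    rw [mul_assoc]
    refine mul_le_mul_right ?_ _
    have e : x + h + (c - h) = x + c := by abel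
    rw [e, add_mul, add_mul, mul_add, mul_add, mul_add]
    have d1 := decayWeight_le_one (x + c)
    have d2 := decayWeight_le_one x
    have p1 : ∀ a : ℝ≥0∞, a * (2 * decayWeight (x + c)) ≤ 2 * a := fun a => by
      rw [mul_left_comm]
      gcongr
      exact mul_le_of_le_one_right' d1
    refine add_le_add (add_le_add (add_le_add le_rfl (p1 _)) (add_le_add le_rfl (p1 _)))
      (add_le_add ?_ ?_)
    · exact mul_le_of_le_one_left' (pow_le_one' d2 2)
    · rw [mul_left_comm]
      gcongr
      exact hb _ _
  refine lt_of_le_of_lt (lintegral_mono hbound) ?_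
  have t1 := lintegral_singularPart_lt_top
  have t2 : ∀ w, w ≠ 0 → ∫⁻ x, singularPart x * singularPart (x + w) < ∞ := fun w hw =>
    (lintegral_singularPart_mul_le w).trans_lt (ENNReal.mul_lt_top ENNReal.ofReal_lt_top
      (ENNReal.add_lt_top.2 ⟨by simp, truncatedLog_lt_top 1 hw⟩))
  have t3 := lintegral_decayWeight_pow_lt_top (n := 3) le_rfl
  repeat first
    | rw [lintegral_const_mul _ (by fun_prop)]
    | rw [lintegral_add_left (by fun_prop)]
  rw [lintegral_add_right_eq_self (fun x => singularPart x * singularPart (x + (c - h))),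
    lintegral_add_right_eq_self singularPart, lintegral_add_right_eq_self singularPart,
    lintegral_add_right_eq_self (fun x => decayWeight x ^ 3)]
  have := t2 _ hc
  have := t2 _ (sub_ne_zero.2 hch)
  have hCt : C < ∞ := ENNReal.ofReal_lt_top
  clear_value C
  clear hC
  simp only [ENNReal.mul_lt_top_iff, ENNReal.add_lt_top]
  simp [*]

/-! ### Convergence and local integrability of the velocity. -/

lemma lintegral_enorm_kernel_mul_decayWeight_le (y : Plane) :
    ∫⁻ x, ‖biotSavartKernel (x - y)‖ₑ * decayWeight x ^ 3 ≤
      (∫⁻ x, singularPart x) + 2 * ∫⁻ x, decayWeight x ^ 3 := by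
  have h : ∀ x, ‖biotSavartKernel (x - y)‖ₑ * decayWeight x ^ 3 ≤
      singularPart (x - y) + 2 * decayWeight x ^ 3 := fun x => by
    refine (mul_le_mul_left (enorm_biotSavartKernel_le _) _).trans ?_
    rw [add_mul, mul_assoc]
    gcongr
    · exact mul_le_of_le_one_right' (pow_le_one' (decayWeight_le_one x) 3)
    · exact mul_le_of_le_one_left' (decayWeight_le_one _)
  refine (lintegral_mono h).trans ?_
  rw [lintegral_add_left (by fun_prop), lintegral_const_mul _ (by fun_prop),
    lintegral_sub_right_eq_self]

/-- The cubed weight is positive and dominates, up to constants, every bounded function of compact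
support. Hence this one bound yields almost everywhere convergence, local integrability and Fubini
against test fields. -/
lemma lintegral_prod_kernel_mul_decayWeight_lt_top (μ : Measure Plane) [IsFiniteMeasure μ] :
    ∫⁻ x, ∫⁻ y, ‖biotSavartKernel (x - y)‖ₑ * decayWeight x ^ 3 ∂μ < ∞ := by
  rw [lintegral_lintegral_swap (by fun_prop)]
  refine lt_of_le_of_lt (lintegral_mono lintegral_enorm_kernel_mul_decayWeight_le) ?_
  rw [lintegral_const]
  exact ENNReal.mul_lt_top (ENNReal.add_lt_top.2 ⟨lintegral_singularPart_lt_top,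
    ENNReal.mul_lt_top (by simp) (lintegral_decayWeight_pow_lt_top le_rfl)⟩) (measure_lt_top _ _)

lemma ae_integrable_kernel (μ : Measure Plane) [IsFiniteMeasure μ] :
    ∀ᵐ x, Integrable (fun y => biotSavartKernel (x - y)) μ := by
  have h := ae_lt_top (Measurable.lintegral_prod_right' (ν := μ) (f := fun q : Plane × Plane =>
    ‖biotSavartKernel (q.1 - q.2)‖ₑ * decayWeight q.1 ^ 3) (by fun_prop))
    (lintegral_prod_kernel_mul_decayWeight_lt_top μ).ne
  filter_upwards [h] with x hx
  refine ⟨Measurable.aestronglyMeasurable (by fun_prop), ?_⟩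
  rw [lintegral_mul_const _ (by fun_prop)] at hx
  have hb : decayWeight x ^ 3 ≠ 0 := by
    have : 0 < (1 + ‖x‖)⁻¹ := by positivity
    simpa [decayWeight] using this
  exact ENNReal.lt_top_of_mul_ne_top_left hx.ne hb

/-- The convolution of the Biot-Savart kernel with the measure of density `σ` with respect
to `μ`. -/
def kernelConvolution (μ : Measure Plane) (σ : Plane → ℝ) (x : Plane) : Plane := ∫ y, σ y • biotSavartKernel (x - y) ∂μ

lemma measurable_kernelConvolution (μ : Measure Plane) [IsFiniteMeasure μ] {σ : Plane → ℝ}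
    (hσ : Measurable σ) : Measurable (kernelConvolution μ σ) :=
  (StronglyMeasurable.integral_prod_right' (f := fun q : Plane × Plane =>
    σ q.2 • biotSavartKernel (q.1 - q.2)) (Measurable.stronglyMeasurable (by fun_prop))).measurable

lemma enorm_smul_le_of_abs_le_one {σ : Plane → ℝ}
    (hσ1 : ∀ x, |σ x| ≤ 1) {E : Type*} [NormedAddCommGroup E] [NormedSpace ℝ E]
    (y : Plane) (v : E) : ‖σ y • v‖ₑ ≤ ‖v‖ₑ := by
  rw [enorm_smul]
  refine mul_le_of_le_one_left' ?_
  rw [← ofReal_norm, Real.norm_eq_abs, ← ENNReal.ofReal_one]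
  exact ENNReal.ofReal_le_ofReal (hσ1 y)

lemma enorm_kernelConvolution_le (μ : Measure Plane) {σ : Plane → ℝ}
    (hσ1 : ∀ x, |σ x| ≤ 1) (x : Plane) :
    ‖kernelConvolution μ σ x‖ₑ ≤ ∫⁻ y, ‖biotSavartKernel (x - y)‖ₑ ∂μ :=
  (enorm_integral_le_lintegral_enorm _).trans
    (lintegral_mono fun y => enorm_smul_le_of_abs_le_one hσ1 y _)

lemma locallyIntegrable_kernelConvolution (μ : Measure Plane) [IsFiniteMeasure μ] {σ : Plane → ℝ}
    (hσ : Measurable σ) (hσ1 : ∀ x, |σ x| ≤ 1) : LocallyIntegrable (kernelConvolution μ σ) := by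
  rw [locallyIntegrable_iff]
  intro k hk
  refine ⟨(measurable_kernelConvolution μ hσ).aestronglyMeasurable, ?_⟩
  obtain ⟨R, hR⟩ := hk.isBounded.exists_norm_le
  have h1 : ∀ x ∈ k, 1 ≤ ENNReal.ofReal (1 + R) ^ 3 * decayWeight x ^ 3 := by
    intro x hx
    have := hR x hx
    have h0 := norm_nonneg x
    rw [← mul_pow, decayWeight, ← ENNReal.ofReal_mul (by linarith)]
    refine one_le_pow₀ ?_
    rw [ENNReal.one_le_ofReal, ← div_eq_mul_inv, one_le_div (by positivity)]
    linarith
  calc ∫⁻ x in k, ‖kernelConvolution μ σ x‖ₑ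
      ≤ ∫⁻ x in k, ENNReal.ofReal (1 + R) ^ 3 *
          ∫⁻ y, ‖biotSavartKernel (x - y)‖ₑ * decayWeight x ^ 3 ∂μ := by
        refine setLIntegral_mono' hk.measurableSet fun x hx => ?_
        refine (enorm_kernelConvolution_le μ hσ1 x).trans ?_
        rw [lintegral_mul_const _ (by fun_prop), mul_left_comm]
        exact le_mul_of_one_le_right' (h1 x hx)
    _ ≤ ∫⁻ x, ENNReal.ofReal (1 + R) ^ 3 *
          ∫⁻ y, ‖biotSavartKernel (x - y)‖ₑ * decayWeight x ^ 3 ∂μ := setLIntegral_le_lintegral _ _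
    _ < ∞ := by
        rw [lintegral_const_mul' _ _ (ENNReal.pow_ne_top ENNReal.ofReal_ne_top)]
        exact ENNReal.mul_lt_top (ENNReal.pow_lt_top ENNReal.ofReal_lt_top)
          (lintegral_prod_kernel_mul_decayWeight_lt_top μ)

lemma exists_enorm_le_decayWeight {E : Type*} [NormedAddCommGroup E] {g : Plane → E}
    (hg : Continuous g) (hc : HasCompactSupport g) :
    ∃ C < ∞, ∀ x, ‖g x‖ₑ ≤ C * decayWeight x ^ 3 := by
  obtain ⟨R, hR⟩ := hc.isCompact.isBounded.exists_norm_le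
  obtain ⟨B, hB⟩ := hc.exists_bound_of_continuous hg
  have hB0 : 0 ≤ B := (norm_nonneg _).trans (hB 0)
  refine ⟨ENNReal.ofReal (B * (1 + R) ^ 3), ENNReal.ofReal_lt_top, fun x => ?_⟩
  by_cases hx : x ∈ tsupport g
  · have := hR x hx
    have h0 := norm_nonneg x
    rw [← ofReal_norm, decayWeight, ← ENNReal.ofReal_pow (by positivity),
      ← ENNReal.ofReal_mul (by have : 0 ≤ R := h0.trans this; positivity), mul_assoc, ← mul_pow]
    refine ENNReal.ofReal_le_ofReal ((hB x).trans (le_mul_of_one_le_right hB0 (one_le_pow₀ ?_)))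
    rw [← div_eq_mul_inv, one_le_div (by positivity)]
    linarith
  · simp [image_eq_zero_of_notMem_tsupport hx]

/-! ### Divergence and curl in the sense of distributions. -/

/-- Fubini and translation reduce both weak equations for u to K tested against translates of the
test field. -/
lemma integral_inner_kernelConvolution (μ : Measure Plane) [IsFiniteMeasure μ] {σ : Plane → ℝ}
    (hσ : Measurable σ) (hσ1 : ∀ x, |σ x| ≤ 1) {g : Plane → Plane} (hg : Continuous g)
    (hc : HasCompactSupport g) :
    ∫ x, inner ℝ (kernelConvolution μ σ x) (g x) =
      ∫ y, σ y * ∫ x, inner ℝ (biotSavartKernel x) (g (x + y)) ∂volume ∂μ := by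
  obtain ⟨C, hC, hgC⟩ := exists_enorm_le_decayWeight hg hc
  have hgm := hg.measurable
  have hi : Integrable (fun q : Plane × Plane => inner ℝ (g q.1) (σ q.2 • biotSavartKernel (q.1 - q.2)))
      (volume.prod μ) := by
    refine ⟨Measurable.aestronglyMeasurable (by fun_prop), ?_⟩
    rw [HasFiniteIntegral, lintegral_prod _ (by fun_prop)]
    refine lt_of_le_of_lt (lintegral_mono fun x => lintegral_mono
      (g := fun y => C * (‖biotSavartKernel (x - y)‖ₑ * decayWeight x ^ 3)) fun y => ?_) ?_
    · have h1 : ‖inner ℝ (g x) (σ y • biotSavartKernel (x - y))‖ₑ ≤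
          ‖g x‖ₑ * ‖σ y • biotSavartKernel (x - y)‖ₑ := by
        simp only [← ofReal_norm]
        rw [← ENNReal.ofReal_mul (norm_nonneg _)]
        exact ENNReal.ofReal_le_ofReal (norm_inner_le_norm _ _)
      refine h1.trans ((mul_le_mul' (hgC x) (enorm_smul_le_of_abs_le_one hσ1 y _)).trans ?_)
      rw [mul_assoc, mul_comm (decayWeight x ^ 3)]
    · simp_rw [lintegral_const_mul' C _ hC.ne]
      exact ENNReal.mul_lt_top hC (lintegral_prod_kernel_mul_decayWeight_lt_top μ)
  have h1 : ∀ᵐ x, inner ℝ (kernelConvolution μ σ x) (g x) =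
      ∫ y, inner ℝ (g x) (σ y • biotSavartKernel (x - y)) ∂μ := by
    filter_upwards [ae_integrable_kernel μ] with x hx
    rw [integral_inner, real_inner_comm]
    · rfl
    · exact hx.bdd_smul 1 hσ.aestronglyMeasurable (.of_forall hσ1)
  rw [integral_congr_ae h1, integral_integral_swap hi]
  refine integral_congr_ae (.of_forall fun y => ?_)
  dsimp only
  simp_rw [inner_smul_right]
  rw [integral_const_mul, ← integral_add_right_eq_self _ y]
  simp_rw [add_sub_cancel_right, real_inner_comm]

lemma integrable_inner_kernel {g : Plane → Plane} (hg : Continuous g) (hc : HasCompactSupport g) :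
    Integrable fun x => inner ℝ (biotSavartKernel x) (g x) := by
  obtain ⟨C, hC, hgC⟩ := exists_enorm_le_decayWeight hg hc
  have hgm := hg.measurable
  refine ⟨Measurable.aestronglyMeasurable (by fun_prop), ?_⟩
  refine lt_of_le_of_lt (lintegral_mono
    (g := fun x => C * (‖biotSavartKernel (x - 0)‖ₑ * decayWeight x ^ 3)) fun x => ?_) ?_
  · have h1 : ‖inner ℝ (biotSavartKernel x) (g x)‖ₑ ≤ ‖biotSavartKernel x‖ₑ * ‖g x‖ₑ := by
      simp only [← ofReal_norm]
      rw [← ENNReal.ofReal_mul (norm_nonneg _)]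
      exact ENNReal.ofReal_le_ofReal (norm_inner_le_norm _ _)
    refine h1.trans ((mul_le_mul_right (hgC x) _).trans ?_)
    simp only [sub_zero]
    rw [mul_left_comm]
  · rw [lintegral_const_mul' C _ hC.ne]
    exact ENNReal.mul_lt_top hC ((lintegral_enorm_kernel_mul_decayWeight_le 0).trans_lt
      (ENNReal.add_lt_top.2 ⟨lintegral_singularPart_lt_top,
        ENNReal.mul_lt_top (by simp) (lintegral_decayWeight_pow_lt_top le_rfl)⟩))

lemma fderiv_plane (φ : Plane → ℝ) (x v : Plane) :
    fderiv ℝ φ x v = v 0 * planePartial 0 φ x + v 1 * planePartial 1 φ x := by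
  have : v = v 0 • EuclideanSpace.single 0 1 + v 1 • EuclideanSpace.single 1 1 := by
    ext i; fin_cases i <;> simp
  conv_lhs => rw [this]
  rw [map_add, map_smul, map_smul]
  rfl

/-- The gradient of `φ`. -/
def planeGradient (φ : Plane → ℝ) (x : Plane) : Plane := !₂[planePartial 0 φ x, planePartial 1 φ x]

/-- The rotated gradient `(∂₂φ, -∂₁φ)`. -/
def planeCurlGradient (φ : Plane → ℝ) (x : Plane) : Plane :=
  !₂[planePartial 1 φ x, -planePartial 0 φ x]

lemma continuous_planePartial {φ : Plane → ℝ} (hφ : ContDiff ℝ 1 φ) (i : Fin 2) :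
    Continuous (planePartial i φ) :=
  (hφ.continuous_fderiv one_ne_zero).clm_apply continuous_const

lemma hasCompactSupport_planePartial {φ : Plane → ℝ} (hc : HasCompactSupport φ) (i : Fin 2) :
    HasCompactSupport (planePartial i φ) :=
  hc.fderiv_apply ℝ _

lemma hasCompactSupport_planeVector {p q : Plane → ℝ} (hp : HasCompactSupport p)
    (hq : HasCompactSupport q) : HasCompactSupport fun x => (!₂[p x, q x] : Plane) :=
  HasCompactSupport.intro (hp.isCompact.union hq.isCompact) fun x hx => by
    rw [mem_union, not_or] at hx
    ext i
    fin_cases i <;> simp [image_eq_zero_of_notMem_tsupport hx.1, image_eq_zero_of_notMem_tsupport hx.2]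

lemma continuous_planeVector {p q : Plane → ℝ} (hp : Continuous p)
    (hq : Continuous q) : Continuous fun x => (!₂[p x, q x] : Plane) := by
  fun_prop

lemma continuous_planeGradient {φ : Plane → ℝ}
    (hφ : ContDiff ℝ 1 φ) : Continuous (planeGradient φ) :=
  continuous_planeVector (continuous_planePartial hφ 0) (continuous_planePartial hφ 1)

lemma hasCompactSupport_planeGradient {φ : Plane → ℝ}
    (hc : HasCompactSupport φ) : HasCompactSupport (planeGradient φ) :=
  hasCompactSupport_planeVector (hasCompactSupport_planePartial hc 0)
    (hasCompactSupport_planePartial hc 1)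

lemma continuous_planeCurlGradient {φ : Plane → ℝ}
    (hφ : ContDiff ℝ 1 φ) : Continuous (planeCurlGradient φ) :=
  continuous_planeVector (continuous_planePartial hφ 1) (continuous_planePartial hφ 0).neg

lemma hasCompactSupport_planeCurlGradient {φ : Plane → ℝ}
    (hc : HasCompactSupport φ) : HasCompactSupport (planeCurlGradient φ) :=
  hasCompactSupport_planeVector (hasCompactSupport_planePartial hc 1)
    (hasCompactSupport_planePartial hc 0).neg

lemma inner_planeGradient (φ : Plane → ℝ) (v x : Plane) : inner ℝ v (planeGradient φ x) = fderiv ℝ φ x v := by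
  rw [inner_plane, fderiv_plane]; rfl

lemma inner_kernel_planeCurlGradient (φ : Plane → ℝ) (x : Plane) :
    inner ℝ (biotSavartKernel x) (planeCurlGradient φ x) =
      -(2 * Real.pi * ‖x‖ ^ 2)⁻¹ * fderiv ℝ φ x x := by
  rw [inner_plane, fderiv_plane]
  simp [biotSavartKernel, planeCurlGradient]
  ring

/-- K is tangential to circles about 0, so on each circle the integrand is a multiple of an angular
derivative and integrates to 0 over a full turn. -/
lemma integral_inner_kernel_planeGradient {φ : Plane → ℝ}
    (hφ : ContDiff ℝ 1 φ) (hc : HasCompactSupport φ) :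
    ∫ x, inner ℝ (biotSavartKernel x) (planeGradient φ x) = 0 := by
  have hi := integrable_inner_kernel (continuous_planeGradient hφ) (hasCompactSupport_planeGradient hc)
  have hm := (continuous_planeGradient hφ).measurable
  rw [integral_eq_circleAverage hi (Measurable.stronglyMeasurable (by fun_prop))]
  refine setIntegral_eq_zero_of_forall_eq_zero fun ρ (hρ : 0 < ρ) => ?_
  rw [Real.circleAverage_def]
  have hd : ∀ θ, HasDerivAt (fun θ => φ (complexPlane (circleMap 0 ρ θ)))
      (fderiv ℝ φ (complexPlane (circleMap 0 ρ θ)) (complexPlane (circleMap 0 ρ θ * Complex.I))) θ := by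
    intro θ
    have h1 := (hφ.differentiable one_ne_zero (complexPlane (circleMap 0 ρ θ))).hasFDerivAt
    have h2 : HasDerivAt (fun θ => complexPlane (circleMap 0 ρ θ))
        (complexPlane (circleMap 0 ρ θ * Complex.I)) θ :=
      (complexPlane.toContinuousLinearEquiv.toContinuousLinearMap.hasFDerivAt).comp_hasDerivAt θ
        (hasDerivAt_circleMap 0 ρ θ)
    exact h1.comp_hasDerivAt θ h2
  have hK : ∀ z : ℂ, biotSavartKernel (complexPlane z) =
      (2 * Real.pi * ‖z‖ ^ 2)⁻¹ • complexPlane (z * Complex.I) := by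
    intro z
    ext i
    fin_cases i <;> simp [biotSavartKernel, complexPlane_zero_apply, complexPlane_one_apply]
  simp only [inner_planeGradient, hK, map_smul, norm_circleMap_zero, smul_eq_mul]
  rw [intervalIntegral.integral_const_mul,
    intervalIntegral.integral_eq_sub_of_hasDerivAt (fun θ _ => hd θ)]
  · simp [circleMap]
  · refine Continuous.intervalIntegrable ?_ _ _
    refine ((hφ.continuous_fderiv one_ne_zero).comp (complexPlane.continuous.comp
      (continuous_circleMap 0 ρ))).clm_apply (complexPlane.continuous.comp ?_)
    exact (continuous_circleMap 0 ρ).mul continuous_const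

/-- Against the rotated gradient K sees only the radial derivative. With the Jacobian, each ray
carries the integral of -(2π)⁻¹ ∂_ρφ, which is φ(0)/(2π); integrating over the angle gives φ(0). -/
lemma integral_inner_kernel_planeCurlGradient {φ : Plane → ℝ}
    (hφ : ContDiff ℝ 1 φ) (hc : HasCompactSupport φ) :
    ∫ x, inner ℝ (biotSavartKernel x) (planeCurlGradient φ x) = φ 0 := by
  have hi := integrable_inner_kernel (continuous_planeCurlGradient hφ)
    (hasCompactSupport_planeCurlGradient hc)
  have hm := (continuous_planeCurlGradient hφ).measurable
  have hp := integrableOn_polar hi (Measurable.stronglyMeasurable (by fun_prop))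
  rw [IntegrableOn, Measure.volume_eq_prod, ← Measure.prod_restrict] at hp
  rw [integral_polar, Measure.volume_eq_prod, ← Measure.prod_restrict, integral_prod_symm _ hp]
  have key : ∀ θ : ℝ, ∫ ρ in Ioi (0 : ℝ), ρ • inner ℝ (biotSavartKernel (complexPlane (circleMap 0 ρ θ)))
      (planeCurlGradient φ (complexPlane (circleMap 0 ρ θ))) = (2 * Real.pi)⁻¹ * φ 0 := by
    intro θ
    set e := complexPlane (circleMap 0 1 θ) with he
    have hne : ‖e‖ = 1 := by simp [he]
    have hs : ∀ ρ : ℝ, complexPlane (circleMap 0 ρ θ) = ρ • e := by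
      intro ρ
      rw [he, ← map_smul]
      simp [circleMap]
    have hf : ContDiff ℝ 1 fun ρ : ℝ => φ (ρ • e) := hφ.comp (contDiff_id.smul contDiff_const)
    have hcs : HasCompactSupport fun ρ : ℝ => φ (ρ • e) := by
      obtain ⟨R, hR⟩ := hc.isCompact.isBounded.exists_norm_le
      refine HasCompactSupport.intro (isCompact_Icc (a := -R) (b := R)) fun ρ hρ => ?_
      refine image_eq_zero_of_notMem_tsupport fun h => hρ ?_
      have := hR _ h
      rw [norm_smul, hne, mul_one, Real.norm_eq_abs] at this
      exact abs_le.1 this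
    have hd : ∀ ρ : ℝ, deriv (fun ρ : ℝ => φ (ρ • e)) ρ = fderiv ℝ φ (ρ • e) e := by
      intro ρ
      have h1 := (hφ.differentiable one_ne_zero (ρ • e)).hasFDerivAt
      have h2 : HasDerivAt (fun ρ : ℝ => ρ • e) e ρ := by
        simpa using (hasDerivAt_id ρ).smul_const e
      exact (h1.comp_hasDerivAt ρ h2).deriv
    have h3 := hcs.integral_Ioi_deriv_eq hf 0
    rw [zero_smul] at h3
    rw [← neg_neg (φ 0), ← h3, mul_neg, ← neg_mul, ← integral_const_mul]
    refine setIntegral_congr_fun measurableSet_Ioi fun ρ (hρ : 0 < ρ) => ?_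
    rw [hs, inner_kernel_planeCurlGradient, hd, map_smul, norm_smul, hne]
    simp only [smul_eq_mul, mul_one, Real.norm_eq_abs, sq_abs]
    field_simp
  simp_rw [key]
  have h2 : Real.pi - -Real.pi = 2 * Real.pi := by ring
  rw [setIntegral_const, measureReal_def, Real.volume_Ioo, h2,
    ENNReal.toReal_ofReal (by positivity), smul_eq_mul]
  field_simp

lemma planePartial_comp_add (i : Fin 2) (φ : Plane → ℝ) (x y : Plane) :
    planePartial i (fun x => φ (x + y)) x = planePartial i φ (x + y) := by
  simp only [planePartial, fderiv_comp_add_right]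

lemma integral_kernelConvolution_gradient (μ : Measure Plane) [IsFiniteMeasure μ] {σ : Plane → ℝ}
    (hσ : Measurable σ) (hσ1 : ∀ x, |σ x| ≤ 1) {φ : Plane → ℝ} (hφ : ContDiff ℝ 1 φ)
    (hc : HasCompactSupport φ) :
    ∫ x, inner ℝ (kernelConvolution μ σ x) (planeGradient φ x) = 0 := by
  rw [integral_inner_kernelConvolution μ hσ hσ1 (continuous_planeGradient hφ)
    (hasCompactSupport_planeGradient hc)]
  refine integral_eq_zero_of_ae (.of_forall fun y => ?_)
  have h := integral_inner_kernel_planeGradient (φ := fun x => φ (x + y))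
    (hφ.comp (contDiff_id.add contDiff_const)) (hc.comp_homeomorph (Homeomorph.addRight y))
  simp only [planeGradient, planePartial_comp_add] at h
  simp [planeGradient, h]

lemma integral_kernelConvolution_curlGradient (μ : Measure Plane) [IsFiniteMeasure μ] {σ : Plane → ℝ}
    (hσ : Measurable σ) (hσ1 : ∀ x, |σ x| ≤ 1) {φ : Plane → ℝ} (hφ : ContDiff ℝ 1 φ)
    (hc : HasCompactSupport φ) :
    ∫ x, inner ℝ (kernelConvolution μ σ x) (planeCurlGradient φ x) = ∫ y, σ y * φ y ∂μ := by
  rw [integral_inner_kernelConvolution μ hσ hσ1 (continuous_planeCurlGradient hφ)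
    (hasCompactSupport_planeCurlGradient hc)]
  refine integral_congr_ae (.of_forall fun y => ?_)
  have h := integral_inner_kernel_planeCurlGradient (φ := fun x => φ (x + y))
    (hφ.comp (contDiff_id.add contDiff_const)) (hc.comp_homeomorph (Homeomorph.addRight y))
  simp only [planeCurlGradient, planePartial_comp_add, zero_add] at h
  simp [planeCurlGradient, h]

/-! ### The quadratic form of the increments. -/

lemma truncatedLog_one_zero : truncatedLog 1 0 = ∞ := by
  by_contra h
  have h1 : IntervalIntegrable (fun s : ℝ => s⁻¹) volume 0 1 := by
    rw [intervalIntegrable_iff_integrableOn_Ioc_of_le zero_le_one]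
    refine ⟨measurable_inv.aestronglyMeasurable, lt_of_le_of_lt (le_of_eq ?_) (lt_top_iff_ne_top.2 h)⟩
    refine setLIntegral_congr_fun measurableSet_Ioc fun s hs => ?_
    have : ‖(0 : Plane)‖ ≤ s := by simpa using hs.1.le
    rw [if_pos this, ← ENNReal.ofReal_inv_of_pos hs.1,
      Real.enorm_eq_ofReal (inv_nonneg.2 hs.1.le)]
  rw [intervalIntegrable_inv_iff] at h1
  simp at h1

/-- The truncated logarithm is infinite at 0, so finite energy makes the diagonal null. The
correlation formula, which needs w ≠ 0, then applies to almost every pair. -/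
lemma ae_prod_sub_ne_zero (μ : Measure Plane) [IsFiniteMeasure μ]
    (hμ : ∫⁻ y, ∫⁻ z, truncatedLog 1 (y - z) ∂μ ∂μ < ∞) :
    ∀ᵐ q ∂(μ.prod μ), q.1 - q.2 ≠ 0 := by
  have hm : Measurable fun q : Plane × Plane => truncatedLog 1 (q.1 - q.2) := by fun_prop
  have h := ae_lt_top (μ := μ.prod μ) hm (by
    rw [lintegral_prod _ hm.aemeasurable]
    exact hμ.ne)
  filter_upwards [h] with q hq h0
  rw [h0, truncatedLog_one_zero] at hq
  exact lt_irrefl _ hq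

/-- Each of the two averaged differences is at most πr² log⁺(r/|w|), and the prefactor is 1/(2π).
The exceptional increments h = ±w are a null set. -/
lemma setIntegral_ball_integral_increment {r : ℝ} (hr : 0 < r) {w : Plane} (hw : w ≠ 0) :
    |∫ h in Metric.ball (0 : Plane) r, ∫ x, inner ℝ (kernelIncrement h x) (kernelIncrement h (x + w))|
      ≤ r ^ 2 * Real.posLog (r / ‖w‖) := by
  have h0 : ∀ c : Plane, ∀ᵐ h : Plane, h ≠ c := fun c => by
    rw [ae_iff]; simp
  have h1 : (∫ h in Metric.ball (0 : Plane) r, ∫ x, inner ℝ (kernelIncrement h x)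
      (kernelIncrement h (x + w))) = ∫ h in Metric.ball (0 : Plane) r, (2 * Real.pi)⁻¹ *
      ((Real.log ‖w + h‖ - Real.log ‖w‖) + (Real.log ‖w - h‖ - Real.log ‖w‖)) := by
    refine setIntegral_congr_ae measurableSet_ball ?_
    filter_upwards [h0 w, h0 (-w)] with h h2 h3 _
    refine integral_inner_increment_increment hw h2.symm ?_
      fun c hc hch => integrable_inner_increment_kernel hc hch
    intro h4
    exact h3 (eq_neg_of_add_eq_zero_right h4)
  have i0 : IntegrableOn (fun _ : Plane => Real.log ‖w‖) (Metric.ball 0 r) :=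
    integrableOn_const measure_ball_lt_top.ne
  have i1 := (integrableOn_log_norm_add w r).sub i0
  have i2 : IntegrableOn (fun h => Real.log ‖w - h‖ - Real.log ‖w‖) (Metric.ball 0 r) := by
    rw [← integrable_indicator_iff measurableSet_ball]
    have := ((integrable_indicator_iff measurableSet_ball).2 i1).comp_neg
    refine this.congr (.of_forall fun x => ?_)
    simp [indicator, sub_eq_add_neg]
  rw [h1, integral_const_mul]
  have e : ∫ h in Metric.ball (0 : Plane) r,
      ((Real.log ‖w + h‖ - Real.log ‖w‖) + (Real.log ‖w - h‖ - Real.log ‖w‖)) =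
      (∫ h in Metric.ball (0 : Plane) r, (Real.log ‖w + h‖ - Real.log ‖w‖)) +
      ∫ h in Metric.ball (0 : Plane) r, (Real.log ‖w - h‖ - Real.log ‖w‖) := integral_add i1 i2
  rw [e]
  obtain ⟨a1, a2⟩ := setIntegral_ball_log_norm_add hw hr
  obtain ⟨b1, b2⟩ := setIntegral_ball_log_norm_sub hw hr
  have hpi := Real.pi_pos
  rw [abs_of_nonneg (by positivity), inv_mul_le_iff₀ (by positivity)]
  linarith

/-- The integrand of the quadratic form of the increments of `kernelConvolution μ σ`. -/
def incrementForm (σ : Plane → ℝ) (p q : Plane × Plane) : ℝ :=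
  inner ℝ (σ q.1 • kernelIncrement p.1 (p.2 - q.1)) (σ q.2 • kernelIncrement p.1 (p.2 - q.2))

lemma measurable_incrementForm {σ : Plane → ℝ} (hσ : Measurable σ) :
    Measurable (Function.uncurry (incrementForm σ)) := by
  unfold Function.uncurry incrementForm kernelIncrement
  fun_prop

lemma enorm_incrementForm_le {σ : Plane → ℝ} (hσ1 : ∀ x, |σ x| ≤ 1) (p q : Plane × Plane) :
    ‖incrementForm σ p q‖ₑ ≤
      ‖kernelIncrement p.1 (p.2 - q.1)‖ₑ * ‖kernelIncrement p.1 (p.2 - q.2)‖ₑ := by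
  refine le_trans ?_ (mul_le_mul' (enorm_smul_le_of_abs_le_one hσ1 q.1 _)
    (enorm_smul_le_of_abs_le_one hσ1 q.2 _))
  simp only [← ofReal_norm]
  rw [← ENNReal.ofReal_mul (norm_nonneg _)]
  exact ENNReal.ofReal_le_ofReal (norm_inner_le_norm _ _)

/-- For fixed h and x the product bound integrates over μ × μ to the square of a single convolution,
which is integrable in x uniformly in h. -/
lemma integrable_incrementForm (μ : Measure Plane) [IsFiniteMeasure μ]
    (hμ : ∫⁻ y, ∫⁻ z, truncatedLog 1 (y - z) ∂μ ∂μ < ∞) {σ : Plane → ℝ} (hσ : Measurable σ)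
    (hσ1 : ∀ x, |σ x| ≤ 1) {r : ℝ} (hr : 0 < r) :
    Integrable (Function.uncurry (incrementForm σ))
      (((volume.restrict (Metric.ball 0 r)).prod volume).prod (μ.prod μ)) := by
  have hm := measurable_incrementForm hσ
  refine ⟨hm.aestronglyMeasurable, ?_⟩
  obtain ⟨C, hC, hCb⟩ := exists_lintegral_increment_convolution_sq_le μ hμ hr.le
  have hD : Measurable fun q : (Plane × Plane) × Plane => ‖kernelIncrement q.1.1 (q.1.2 - q.2)‖ₑ := by
    unfold kernelIncrement; fun_prop
  have hG : Measurable fun p : Plane × Plane => ∫⁻ y, ‖kernelIncrement p.1 (p.2 - y)‖ₑ ∂μ :=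
    hD.lintegral_prod_right'
  rw [HasFiniteIntegral, lintegral_prod _ hm.enorm.aemeasurable]
  calc _ ≤ ∫⁻ p, (∫⁻ y, ‖kernelIncrement p.1 (p.2 - y)‖ₑ ∂μ) ^ 2
        ∂((volume.restrict (Metric.ball 0 r)).prod volume) := by
        refine lintegral_mono fun p => ?_
        refine (lintegral_mono fun q => enorm_incrementForm_le hσ1 p q).trans (le_of_eq ?_)
        rw [lintegral_prod_mul (f := fun y => ‖kernelIncrement p.1 (p.2 - y)‖ₑ)
          (g := fun y => ‖kernelIncrement p.1 (p.2 - y)‖ₑ) (by fun_prop) (by fun_prop), sq]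
    _ = ∫⁻ h in Metric.ball 0 r, ∫⁻ x, (∫⁻ y, ‖kernelIncrement h (x - y)‖ₑ ∂μ) ^ 2 :=
        lintegral_prod _ (hG.pow_const 2).aemeasurable
    _ ≤ ∫⁻ h in Metric.ball (0 : Plane) r, C := by
        refine setLIntegral_mono' measurableSet_ball fun h hh => hCb h ?_
        exact (mem_ball_zero_iff.1 hh).le
    _ < ∞ := by
        rw [lintegral_const, Measure.restrict_apply_univ]
        exact ENNReal.mul_lt_top hC measure_ball_lt_top

lemma integral_prod_inner_self {μ : Measure Plane} [IsFiniteMeasure μ] {f : Plane → Plane}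
    (hf : Integrable f μ) :
    ∫ q : Plane × Plane, inner ℝ (f q.1) (f q.2) ∂(μ.prod μ) = ‖∫ y, f y ∂μ‖ ^ 2 := by
  have hi : Integrable (fun q : Plane × Plane => inner ℝ (f q.1) (f q.2)) (μ.prod μ) := by
    refine (hf.norm.mul_prod hf.norm).mono' ?_ (.of_forall fun q => norm_inner_le_norm _ _)
    exact hf.aestronglyMeasurable.comp_fst.inner hf.aestronglyMeasurable.comp_snd
  have h : ∀ y, ∫ z, inner ℝ (f y) (f z) ∂μ = inner ℝ (∫ z, f z ∂μ) (f y) := by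
    intro y
    rw [integral_inner hf, real_inner_comm]
  rw [integral_prod _ hi]
  simp only [h]
  rw [integral_inner hf, real_inner_self_eq_norm_sq]

lemma ae_enorm_kernelConvolution_sub_sq (μ : Measure Plane) [IsFiniteMeasure μ] {σ : Plane → ℝ}
    (hσ : Measurable σ) (hσ1 : ∀ x, |σ x| ≤ 1) (h : Plane) :
    ∀ᵐ x, ‖kernelConvolution μ σ (x + h) - kernelConvolution μ σ x‖ ^ 2 =
      ∫ q, incrementForm σ (h, x) q ∂(μ.prod μ) := by
  have h1 := ae_integrable_kernel μ
  have h2 : ∀ᵐ x, Integrable (fun y => biotSavartKernel (x + h - y)) μ :=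
    (measurePreserving_add_right volume h).quasiMeasurePreserving.ae h1
  filter_upwards [h1, h2] with x hx hxh
  have hx' : Integrable (fun y => σ y • biotSavartKernel (x - y)) μ :=
    hx.bdd_smul 1 hσ.aestronglyMeasurable (.of_forall hσ1)
  have hxh' : Integrable (fun y => σ y • biotSavartKernel (x + h - y)) μ :=
    hxh.bdd_smul 1 hσ.aestronglyMeasurable (.of_forall hσ1)
  have e : ∀ y, σ y • biotSavartKernel (x + h - y) - σ y • biotSavartKernel (x - y) =
      σ y • kernelIncrement h (x - y) := by
    intro y
    rw [← smul_sub, kernelIncrement, sub_add_eq_add_sub]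
  have hi := hxh'.sub hx'
  have hi2 : Integrable (fun y => σ y • kernelIncrement h (x - y)) μ := by
    simp only [← e]
    exact hi
  rw [kernelConvolution, kernelConvolution, ← integral_sub hxh' hx']
  simp_rw [e]
  exact (integral_prod_inner_self hi2).symm

/-- The h- and x-integrals are carried out before absolute values are taken, so the cancellation in
the second difference survives; only then are the signs bounded by 1. -/
lemma lintegral_ball_increment_sq_le (μ : Measure Plane) [IsFiniteMeasure μ] {M : ℝ → ℝ≥0∞}
    (hM : ∀ z s, μ (Metric.closedBall z s) ≤ M s)
    (hM1 : ∫⁻ s in Ioc 0 1, M s / ENNReal.ofReal s < ∞) {σ : Plane → ℝ}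
    (hσ : Measurable σ) (hσ1 : ∀ x, |σ x| ≤ 1) {r : ℝ} (hr : 0 < r) :
    ∫⁻ h in Metric.ball (0 : Plane) r, ∫⁻ x,
      ‖kernelConvolution μ σ (x + h) - kernelConvolution μ σ x‖ₑ ^ 2 ≤
      ENNReal.ofReal (r ^ 2) * (μ univ * ∫⁻ s in Ioc 0 r, M s / ENNReal.ofReal s) := by
  have hμ : ∫⁻ y, ∫⁻ z, truncatedLog 1 (y - z) ∂μ ∂μ < ∞ :=
    (lintegral_truncatedLog_le μ hM 1).trans_lt (ENNReal.mul_lt_top (measure_lt_top _ _) hM1)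
  set ν := (volume.restrict (Metric.ball (0 : Plane) r)).prod (volume : Measure Plane) with hν
  have hF := integrable_incrementForm μ hμ hσ hσ1 hr
  have hFm := measurable_incrementForm hσ
  set Q : Plane × Plane → ℝ := fun p => ∫ q, incrementForm σ p q ∂(μ.prod μ) with hQ
  have hQm : Measurable Q := hFm.stronglyMeasurable.integral_prod_right'.measurable
  have hQi : Integrable Q ν := hF.integral_prod_left
  have hpt := ae_enorm_kernelConvolution_sub_sq μ hσ hσ1
  -- The form equals a square almost everywhere; this sign lets the Lebesgue integral of the square
  -- be rewritten as a Bochner integral, to which Fubini applies.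
  have hQ0 : 0 ≤ᵐ[ν] Q := by
    refine (Measure.ae_prod_mem_iff_ae_ae_mem (s := {p | 0 ≤ Q p}) (hQm measurableSet_Ici)).2
      (.of_forall fun h => ?_)
    filter_upwards [hpt h] with x hx
    change 0 ≤ ∫ q, incrementForm σ (h, x) q ∂(μ.prod μ)
    rw [← hx]
    positivity
  have h1 : ∫⁻ h in Metric.ball (0 : Plane) r, ∫⁻ x,
      ‖kernelConvolution μ σ (x + h) - kernelConvolution μ σ x‖ₑ ^ 2 = ENNReal.ofReal (∫ p, Q p ∂ν) := by
    rw [ofReal_integral_eq_lintegral_ofReal hQi hQ0, hν, lintegral_prod _ (by fun_prop)]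
    refine lintegral_congr fun h => lintegral_congr_ae ?_
    filter_upwards [hpt h] with x hx
    rw [hQ]
    dsimp only
    rw [← hx, ← ofReal_norm, ENNReal.ofReal_pow (norm_nonneg _)]
  have h2 : ∀ᵐ q ∂(μ.prod μ), ‖∫ p, incrementForm σ p q ∂ν‖ₑ ≤
      ENNReal.ofReal (r ^ 2) * truncatedLog r (q.1 - q.2) := by
    filter_upwards [ae_prod_sub_ne_zero μ hμ, hF.prod_left_ae] with q hq hqi
    have h3 : ∫ p, incrementForm σ p q ∂ν = σ q.1 • σ q.2 •
        ∫ h in Metric.ball (0 : Plane) r, ∫ x, inner ℝ (kernelIncrement h x)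
          (kernelIncrement h (x + (q.1 - q.2))) := by
      refine (integral_prod _ hqi).trans ?_
      rw [smul_smul, smul_eq_mul, ← integral_const_mul]
      refine integral_congr_ae (.of_forall fun h => ?_)
      dsimp only [Function.uncurry, incrementForm]
      rw [← integral_const_mul, ← integral_sub_right_eq_self (fun x => σ q.1 * σ q.2 *
        inner ℝ (kernelIncrement h x) (kernelIncrement h (x + (q.1 - q.2)))) q.1]
      refine integral_congr_ae (.of_forall fun x => ?_)
      have : x - q.1 + (q.1 - q.2) = x - q.2 := by abel
      dsimp only
      rw [this, inner_smul_left, inner_smul_right, mul_assoc]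
      rfl
    rw [h3]
    refine (enorm_smul_le_of_abs_le_one hσ1 _ _).trans
      ((enorm_smul_le_of_abs_le_one hσ1 _ _).trans ?_)
    rw [← ofReal_norm, Real.norm_eq_abs]
    refine (ENNReal.ofReal_le_ofReal (setIntegral_ball_integral_increment hr hq)).trans ?_
    rw [ENNReal.ofReal_mul (by positivity)]
    gcongr
    exact ofReal_posLog_le_truncatedLog hr hq
  rw [h1, hQ, integral_integral_swap hF]
  calc ENNReal.ofReal (∫ q, ∫ p, incrementForm σ p q ∂ν ∂(μ.prod μ))
      ≤ ‖∫ q, ∫ p, incrementForm σ p q ∂ν ∂(μ.prod μ)‖ₑ := Real.ofReal_le_enorm _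
    _ ≤ ∫⁻ q, ‖∫ p, incrementForm σ p q ∂ν‖ₑ ∂(μ.prod μ) := enorm_integral_le_lintegral_enorm _
    _ ≤ ∫⁻ q, ENNReal.ofReal (r ^ 2) * truncatedLog r (q.1 - q.2) ∂(μ.prod μ) := lintegral_mono_ae h2
    _ = ENNReal.ofReal (r ^ 2) * ∫⁻ y, ∫⁻ z, truncatedLog r (y - z) ∂μ ∂μ := by
        rw [lintegral_const_mul _ (by fun_prop), lintegral_prod _ (by fun_prop)]
    _ ≤ _ := by
        gcongr
        exact lintegral_truncatedLog_le μ hM r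

/-! ### The structure function estimate and conclusion. -/

lemma structureAverage_congr {u v : Plane → Plane} (h : u =ᵐ[volume] v) (r : ℝ) :
    structureAverage u r = structureAverage v r := by
  unfold structureAverage
  congr with a
  refine lintegral_congr_ae ?_
  have h2 : ∀ᵐ x, u (x + a) = v (x + a) :=
    (measurePreserving_add_right volume a).quasiMeasurePreserving.ae h
  filter_upwards [h, h2] with x hx hxa
  rw [hx, hxa]

lemma structureAverage_kernelConvolution_le (μ : Measure Plane) [IsFiniteMeasure μ] {M : ℝ → ℝ≥0∞}
    (hM : ∀ z s, μ (Metric.closedBall z s) ≤ M s)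
    (hM1 : ∫⁻ s in Ioc 0 1, M s / ENNReal.ofReal s < ∞) {σ : Plane → ℝ}
    (hσ : Measurable σ) (hσ1 : ∀ x, |σ x| ≤ 1) {r : ℝ} (hr : 0 ≤ r) :
    structureAverage (kernelConvolution μ σ) r ≤
      μ univ * ∫⁻ s in Ioc 0 r, M s / ENNReal.ofReal s := by
  -- For r = 0 the ball is empty and the average takes the value 0.
  rcases hr.eq_or_lt with rfl | hr
  · simp [structureAverage]
  rw [structureAverage, setLAverage_eq]
  -- The volume is πr², so bounding it below by r² gives away a factor 1/π.
  have hv : ENNReal.ofReal (r ^ 2) ≤ volume (Metric.ball (0 : Plane) r) := by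
    rw [EuclideanSpace.volume_ball_fin_two, ENNReal.ofReal_pow hr.le]
    refine le_mul_of_one_le_right' ?_
    rw [← ENNReal.ofReal_one]
    exact ENNReal.ofReal_le_ofReal (by linarith [Real.two_le_pi])
  refine ENNReal.div_le_of_le_mul ((lintegral_ball_increment_sq_le μ hM hM1 hσ hσ1 hr).trans ?_)
  rw [mul_comm]
  gcongr

/-- Only small s can cause divergence: for s > 1 the integrand is at most the total mass. -/
lemma vorticityMaximalIntegral_lt_top {ω : SignedMeasure Plane}
    (hω : vorticityMaximalIntegral ω 1 < ∞) (r : ℝ) : vorticityMaximalIntegral ω r < ∞ := by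
  have h1 : vorticityMaximalIntegral ω r ≤ vorticityMaximalIntegral ω 1 +
      ∫⁻ s in Ioc 1 r, vorticityMaximal ω s / ENNReal.ofReal s := by
    refine (lintegral_mono_set (t := Ioc 0 1 ∪ Ioc 1 r) fun x hx => ?_).trans
      (lintegral_union_le _ _ _)
    rcases le_or_gt x 1 with h | h
    · exact Or.inl ⟨hx.1, h⟩
    · exact Or.inr ⟨h, hx.2⟩
  refine h1.trans_lt (ENNReal.add_lt_top.2 ⟨hω, ?_⟩)
  calc ∫⁻ s in Ioc 1 r, vorticityMaximal ω s / ENNReal.ofReal s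
      ≤ ∫⁻ s in Ioc 1 r, ω.totalVariation univ := by
        refine setLIntegral_mono' measurableSet_Ioc fun s hs => ?_
        refine ENNReal.div_le_of_le_mul ((iSup_le fun x => measure_mono (subset_univ _)).trans ?_)
        exact le_mul_of_one_le_right' (by rw [ENNReal.one_le_ofReal]; exact hs.1.le)
    _ < ∞ := by
        rw [lintegral_const, Measure.restrict_apply_univ]
        exact ENNReal.mul_lt_top (measure_lt_top _ _) measure_Ioc_lt_top

end

theorem theorem2p1 (ω : SignedMeasure Plane) (hω : vorticityMaximalIntegral ω 1 < ∞) :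
    -- the convolution `K ∗ ω` converges absolutely almost everywhere, is locally integrable,
    -- and has divergence `0` and curl `ω`
    ((∀ᵐ x : Plane, Integrable (fun y => biotSavartKernel (x - y)) ω.totalVariation) ∧
      LocallyIntegrable (biotSavartVelocity ω) ∧
      WeakDivFree (biotSavartVelocity ω) ∧
      WeakCurlEq (biotSavartVelocity ω) ω) ∧
    -- the structure function estimate, with a finite right-hand side
    ∀ r : ℝ, 0 ≤ r →
      structureAverage (biotSavartVelocity ω) r ≤
          measureNorm ω * vorticityMaximalIntegral ω r ∧
        measureNorm ω * vorticityMaximalIntegral ω r < ∞ := by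
  obtain ⟨σ, hσ, hσ1, hint⟩ := exists_sign_density ω
  have hae := ae_integrable_kernel ω.totalVariation
  -- Equality is claimed only where the kernel is integrable; elsewhere the default value 0 of
  -- divergent integrals may enter the two sides differently.
  have hu : biotSavartVelocity ω =ᵐ[volume] kernelConvolution ω.totalVariation σ := by
    filter_upwards [hae] with x hx
    exact hint _ hx
  refine ⟨⟨hae, ?_, ?_, ?_⟩, fun r hr => ⟨?_, ?_⟩⟩
  · exact (locallyIntegrable_kernelConvolution _ hσ hσ1).congr hu.symm
  · intro φ hφ hc
    have hφ1 : ContDiff ℝ 1 φ := hφ.of_le (by exact_mod_cast le_top)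
    rw [← integral_kernelConvolution_gradient ω.totalVariation hσ hσ1 hφ1 hc]
    refine integral_congr_ae ?_
    filter_upwards [hu] with x hx
    rw [hx, inner_plane]
    rfl
  · intro φ hφ hc
    have hφ1 : ContDiff ℝ 1 φ := hφ.of_le (by exact_mod_cast le_top)
    rw [hint φ (hφ1.continuous.integrable_of_hasCompactSupport hc)]
    refine Eq.trans ?_ (integral_kernelConvolution_curlGradient ω.totalVariation hσ hσ1 hφ1 hc)
    refine integral_congr_ae ?_
    filter_upwards [hu] with x hx
    rw [hx, inner_plane, sub_eq_add_neg, ← mul_neg]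
    rfl
  · rw [structureAverage_congr hu]
    exact structureAverage_kernelConvolution_le ω.totalVariation (M := vorticityMaximal ω)
      (fun z s => le_iSup (fun x => ω.totalVariation (Metric.closedBall x s)) z) hω hσ hσ1 hr
  · exact ENNReal.mul_lt_top (measure_lt_top _ _) (vorticityMaximalIntegral_lt_top hω r)
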